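/- Let $a\in(0,1)$, $p_1,p_2\ge 0$, $p_1+p_2\le 1$, let $\mu$ be a probability measure on $[0,1)$ and $\nu$ a probability measure on $(-\infty,0)$. Let $V_0,V_1,\dots$ have common law $p_1\delta_a+p_2\,\mu+(1-p_1-p_2)\,\nu$ and let $Y_n=B_n-A_n$, $n\ge0$, be identically distributed real random variables, all the $V_n$ and $Y_n$ being independent. Assume that $E(e^{-sY_n})=N_Y(s)/D_Y(s)$ for $\mathrm{Re}\,s=0$, where $N_Y$ is a polynomial and $D_Y(s)=\prod_{j=1}^{L}(s-t_j)\prod_{j=1}^{M}(s-s_j)$ with $\mathrm{Re}\,t_j>0$, $\mathrm{Re}\,s_j<0$. Let $w\ge 0$, $W_0=w$, $W_{n+1}=[V_nW_n+B_n-A_n]^+$, where $x^+=\max(0,x)$, $x^-=\min(0,x)$. Fix $r\in[0,1)$ and put $$Z_w(r,s)=\sum_{n\ge0}r^nE(e^{-sW_n}),\qquad J^-(r,s)=\sum_{n\ge0}r^nE\big(e^{-s[V_nW_n+B_n-A_n]^-}\big)$$ for $\mathrm{Re}\,s\ge0$ and $\mathrm{Re}\,s\le 0$, respectively. Then $Z_w(r,\cdot)$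 is continuous on $\mathrm{Re}\,s\ge0$ and analytic on $\mathrm{Re}\,s>0$, and there are $C_0(r),\dots,C_{M+L}(r)\in\mathbb C$ with the following properties. (1) For $\mathrm{Re}\,s\ge0$, $$D_Y(s)\big(Z_w(r,s)-e^{-sw}\big)-rp_1N_Y(s)Z_w(r,as)-rp_2N_Y(s)\int_{[0,1)}Z_w(r,sy)\,\mu(dy)=\sum_{l=0}^{M+L}C_l(r)s^l,$$ and for $\mathrm{Re}\,s\le0$, $$r(1-p_1-p_2)N_Y(s)\int_{(-\infty,0)}Z_w(r,sy)\,\nu(dy)+rD_Y(s)\Big(\frac1{1-r}-J^-(r,s)\Big)=\sum_{l=0}^{M+L}C_l(r)s^l.$$ (2) With $K(r,s)=rN_Y(s)/D_Y(s)$ and $L_w(r,s)=e^{-sw}+\sum_{l=0}^{M+L}C_l(r)s^l/D_Y(s)$, for all $s$ with $\mathrm{Re}\,s\ge0$ and $D_Y(s)\ne0$, $$Z_w(r,s)=p_1K(r,s)Z_w(r,as)+p_2K(r,s)\int_{[0,1)}Z_w(r,sy)\,\mu(dy)+L_w(r,s).$$ (3) Write $f_{i,j}(s)=a^iy_1\cdots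 y_js$ and let $G_{i,j}(s)=G_{i,j}(s;y_1,\dots,y_j)$ be defined by $G_{0,0}=1$ and $G_{i,j}=G_{i-1,j}K(r,f_{i-1,j}(s))+G_{i,j-1}K(r,f_{i,j-1}(s))$, terms with a negative index being $0$. Then $G_{i,j}$ is the sum, over the $\binom{i+j}{i}$ lattice paths from $(0,0)$ to $(i,j)$ with unit steps $(1,0)$ and $(0,1)$, of the path weights $\prod K(r,f_{l,q}(s))$, the product being over the points $(l,q)$ of the path other than its end point. (4) Let $\mathrm{Re}\,s\ge0$ and $D_Y(xs)\neq0$ for all $x\in[0,1]$ (for example $\mathrm{Re}\,s=0$, or $|s|$ small). Then there is $b<\infty$ such that, for all $0\le m\le k$, every path weight from $(0,0)$ to $(m,k-m)$ is integrable with $\int\cdots\int_{[0,1)^{k-m}}\big|\prod K(r,f_{l,q}(s))\big|\,\mu(dy_1)\cdots\mu(dy_{k-m})\le b$, so that $\big|\int\cdots\int G_{m,k-m}(s)\,\mu(dy_1)\cdots\mu(dy_{k-m})\big|\le b\binom km$. Moreover the functions $G_{i,j}(s)L_w(r,f_{i,j}(s))$ are $\mu^{\otimes j}$-integrable, and $$Z_w(r,s)=\sum_{k=0}^{\infty}\sum_{m=0}^{k}p_1^mp_2^{k-m}\int\cdots\int_{[0,1)^{k-m}}G_{m,k-m}(s)\,L_w(r,f_{m,k-m}(s))\,\mu(dy_1)\cdots\mu(dy_{k-m}),$$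 where the series over $k$ converges absolutely. (5) $C_0(r)=\dfrac{r(1-p_1-p_2)}{1-r}\prod_{j=1}^L(-t_j)\prod_{j=1}^M(-s_j)$, and the coefficients satisfy the linear system $$-rp_1N_Y(t_j)Z_w(r,at_j)-rp_2N_Y(t_j)\int_{[0,1)}Z_w(r,t_jy)\,\mu(dy)=\sum_{l=0}^{M+L}C_l(r)t_j^l,\qquad j=1,\dots,L,$$ $$r(1-p_1-p_2)N_Y(s_j)\int_{(-\infty,0)}Z_w(r,s_jy)\,\nu(dy)=\sum_{l=0}^{M+L}C_l(r)s_j^l,\qquad j=1,\dots,M.$$ If the $t_j$ are pairwise distinct and the $s_j$ are pairwise distinct, this system together with the value of $C_0(r)$ determines $C_1(r),\dots,C_{M+L}(r)$ uniquely. -/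

import Mathlib

open MeasureTheory ProbabilityTheory

noncomputable section

/-- The reflected recursion `W₀ = w`, `W_{n+1} = [V_n W_n + B_n - A_n]⁺`. -/
def waiting {Ω : Type*} (w : ℝ) (V B A : ℕ → Ω → ℝ) : ℕ → Ω → ℝ
  | 0 => fun _ => w
  | n + 1 => fun ω => max (V n ω * waiting w V B A n ω + B n ω - A n ω) 0

/-- `E (exp (-s X))`. -/
def lst {Ω : Type*} [MeasurableSpace Ω] (P : Measure Ω) (X : Ω → ℝ) (s : ℂ) : ℂ :=
  ∫ ω, Complex.exp (-s * (X ω : ℂ)) ∂P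

/-- The transient transform `Z_w(r,s) = ∑_{n ≥ 0} rⁿ E (exp (-s W_n))`. -/
def transZ {Ω : Type*} [MeasurableSpace Ω] (P : Measure Ω) (w : ℝ) (V B A : ℕ → Ω → ℝ)
    (r : ℝ) (s : ℂ) : ℂ :=
  ∑' n : ℕ, (r : ℂ) ^ n * lst P (waiting w V B A n) s

/-- `J⁻(r,s) = ∑_{n ≥ 0} rⁿ E (exp (-s [V_n W_n + B_n - A_n]⁻))`, where `x⁻ = min (0, x)`. -/
def transJ {Ω : Type*} [MeasurableSpace Ω] (P : Measure Ω) (w : ℝ) (V B A : ℕ → Ω → ℝ)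
    (r : ℝ) (s : ℂ) : ℂ :=
  ∑' n : ℕ, (r : ℂ) ^ n *
    lst P (fun ω => min (V n ω * waiting w V B A n ω + B n ω - A n ω) 0) s

/-- `D_Y(z) = ∏ (z - t_j) ∏ (z - s_j)`; here `u` lists the zeros `s_j`. -/
def denomY {L M : ℕ} (t : Fin L → ℂ) (u : Fin M → ℂ) (z : ℂ) : ℂ :=
  (∏ j, (z - t j)) * ∏ j, (z - u j)

/-- `K(r,s) = r φ_Y(s) = r N_Y(s) / D_Y(s)`. -/
def kernK {L M : ℕ} (N : Polynomial ℂ) (t : Fin L → ℂ) (u : Fin M → ℂ) (r : ℝ) (s : ℂ) : ℂ :=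
  (r : ℂ) * (N.eval s / denomY t u s)

/-- `∑_{l=0}^{M+L} C_l s^l`. -/
def polyC {d : ℕ} (C : Fin (d + 1) → ℂ) (s : ℂ) : ℂ :=
  ∑ l, C l * s ^ (l : ℕ)

/-- `L_w(r,s) = exp (-s w) + (∑_l C_l s^l) / D_Y(s)`. -/
def freeL {L M : ℕ} (t : Fin L → ℂ) (u : Fin M → ℂ) (w : ℝ) (C : Fin (M + L + 1) → ℂ)
    (s : ℂ) : ℂ :=
  Complex.exp (-s * (w : ℂ)) + polyC C s / denomY t u s

/-- `f_{i,j}(s) = a^i y_1 ⋯ y_j s` (the sequence `y` is indexed from `0`). -/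
def scaled (a : ℝ) (y : ℕ → ℝ) (i j : ℕ) (s : ℂ) : ℂ :=
  (a : ℂ) ^ i * (∏ q ∈ Finset.range j, (y q : ℂ)) * s

/-- The recursive weights: `G_{0,0} = 1` and
`G_{i,j} = G_{i-1,j} K(f_{i-1,j}(s)) + G_{i,j-1} K(f_{i,j-1}(s))`, with a zero contribution
from a negative index, as functions of the variables `y_1, y_2, …`. -/
def weightG (K : ℂ → ℂ) (a : ℝ) (y : ℕ → ℝ) (s : ℂ) : ℕ → ℕ → ℂ
  | 0, 0 => 1
  | i + 1, 0 => weightG K a y s i 0 * K (scaled a y i 0 s)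
  | 0, j + 1 => weightG K a y s 0 j * K (scaled a y 0 j s)
  | i + 1, j + 1 =>
      weightG K a y s i (j + 1) * K (scaled a y i (j + 1) s) +
        weightG K a y s (i + 1) j * K (scaled a y (i + 1) j s)

/-- A sequence of `n + 1` grid points from `(0,0)` to `(i,j)` with unit steps `(1,0)`, `(0,1)`. -/
def IsLatticePath (n i j : ℕ) (c : Fin (n + 1) → ℕ × ℕ) : Prop :=
  c 0 = (0, 0) ∧ c (Fin.last n) = (i, j) ∧
    ∀ l : Fin n, c l.succ = c l.castSucc + (1, 0) ∨ c l.succ = c l.castSucc + (0, 1)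

open Classical in
/-- All lattice paths with `n` steps from `(0,0)` to `(i,j)`
(such paths stay in the box `[0,i] × [0,j]`). -/
def latticePaths (n i j : ℕ) : Finset (Fin (n + 1) → ℕ × ℕ) :=
  (Fintype.piFinset fun _ : Fin (n + 1) =>
    Finset.range (i + 1) ×ˢ Finset.range (j + 1)).filter (IsLatticePath n i j)

/-- The weight of a path: the product of `K(a^l y_1 ⋯ y_q s)` over its points `(l,q)`
other than the end point. -/
def pathWeight (K : ℂ → ℂ) (a : ℝ) (y : ℕ → ℝ) (s : ℂ) {n : ℕ} (c : Fin (n + 1) → ℕ × ℕ) : ℂ :=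
  ∏ l : Fin n, K (scaled a y (c l.castSucc).1 (c l.castSucc).2 s)

/-- The finite tuple `y_1, …, y_j` continued to a sequence (the continuation plays no role). -/
def padSeq {j : ℕ} (y : Fin j → ℝ) (q : ℕ) : ℝ :=
  if h : q < j then y ⟨q, h⟩ else 1

/-- The law `μ(dy_1) ⋯ μ(dy_j)`. -/
def prodLaw (μ : Measure ℝ) (j : ℕ) : Measure (Fin j → ℝ) :=
  Measure.pi fun _ : Fin j => μ

/-- The equations obtained at the zeros `t_j` (right half plane) of `D_Y`. -/
def SystemT {L M : ℕ} (N : Polynomial ℂ) (t : Fin L → ℂ) (Z : ℂ → ℂ) (μ : Measure ℝ)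
    (a p₁ p₂ r : ℝ) (C : Fin (M + L + 1) → ℂ) : Prop :=
  ∀ j : Fin L,
    -((r : ℂ) * p₁ * N.eval (t j) * Z (a * t j))
      - (r : ℂ) * p₂ * N.eval (t j) * ∫ y, Z (t j * (y : ℂ)) ∂μ = polyC C (t j)

/-- The equations obtained at the zeros `s_j` (left half plane) of `D_Y`. -/
def SystemS {L M : ℕ} (N : Polynomial ℂ) (u : Fin M → ℂ) (Z : ℂ → ℂ) (ν : Measure ℝ)
    (p₁ p₂ r : ℝ) (C : Fin (M + L + 1) → ℂ) : Prop :=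
  ∀ j : Fin M,
    (r : ℂ) * (1 - p₁ - p₂) * N.eval (u j) * ∫ y, Z (u j * (y : ℂ)) ∂ν = polyC C (u j)

end

/-! The proof is a Wiener-Hopf argument followed by an iteration along lattice paths.

For real x, exp(-s max(x,0)) + exp(-s min(x,0)) = 1 + exp(-sx). On the imaginary axis every
exponential has modulus one, so expectations may be taken without sign conditions. Independence
factors the transform of V_n W_n + Y_n into the rational transform N/D and a mixture of transforms
of W_n (`lst_waiting_succ_add`). Summing against r^n and multiplying by D gives an identity whose
terms separate: those with Z(s), Z(as) and the μ-integral live on Re s ≥ 0, those with J⁻ and the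
ν-integral on Re s ≤ 0, because ν charges negative numbers. The two sides glue to an entire function
(`exists_entire_of_eq_on_imaginary_axis`). The transforms are bounded, and |N/D| ≤ 1 on the axis
forces deg N ≤ deg D = M + L, so the extended Liouville theorem makes the entire function a
polynomial of degree at most M + L (`exists_polyC_half_planes`).

Dividing by D gives the functional equation. Iterating it produces lattice paths, since the scalings
by a and by the y_q commute. The difficulty is convergence: K(0) = r < 1, but |K| may exceed 1 on
the rest of the segment [0,s], so path weights need not decay pointwise. Their means do. For large β
the weight exp(βx) is contracted by a factor ρ < 1 at every step: near x = 0 because |K| is small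
there, and away from 0 because each step multiplies x by a number that is almost surely below 1
(`eventually_mul_integral_exp_le`). The mean weight of a path with n steps is therefore at most a
constant times ρ^n. The number of paths is absorbed by the binomial theorem and p₁ + p₂ ≤ 1, so the
remainder of the iteration tends to 0 (`hasSum_pathTerm`).

The linear system is the polynomial identity at the zeros of D, and C_0 is its value at 0.
Uniqueness is interpolation at M + L + 1 distinct nodes. -/

/-! ### Gluing across the imaginary axis and the extended Liouville theorem -/

/-- A continuous function that is holomorphic off the imaginary axis is entire. -/
theorem differentiable_of_continuous_of_off_imaginary_axis {f : ℂ → ℂ} (hc : Continuous f)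
    (hr : DifferentiableOn ℂ f {s | 0 < s.re}) (hl : DifferentiableOn ℂ f {s | s.re < 0}) :
    Differentiable ℂ f := by
  -- Cauchy's theorem for rectangles with one side on the imaginary axis: the interior lies in a
  -- single half plane, and continuity suffices on the boundary.
  have key : ∀ b c d : ℝ,
      (∫ x : ℝ in (0 : ℝ)..b, f (x + c * Complex.I)) - (∫ x : ℝ in (0 : ℝ)..b, f (x + d * Complex.I))
        + Complex.I • (∫ y : ℝ in c..d, f (b + y * Complex.I))
        - Complex.I • (∫ y : ℝ in c..d, f ((0 : ℝ) + y * Complex.I)) = 0 := by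
    intro b c d
    have := Complex.integral_boundary_rect_eq_zero_of_continuousOn_of_differentiableOn f
      (⟨0, c⟩ : ℂ) (⟨b, d⟩ : ℂ) hc.continuousOn (by
        rcases le_total 0 b with hb | hb
        · refine hr.mono fun s hs => ?_
          have := (Complex.mem_reProdIm.1 hs).1
          simp only [min_eq_left hb] at this
          exact this.1
        · refine hl.mono fun s hs => ?_
          have := (Complex.mem_reProdIm.1 hs).1
          simp only [max_eq_left hb] at this
          exact this.2)
    simpa using this
  have hi : ∀ (c a b : ℝ), IntervalIntegrable (fun x : ℝ => f (x + c * Complex.I)) volume a b :=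
    fun c a b => (hc.comp (by fun_prop)).intervalIntegrable _ _
  rw [← differentiableOn_univ,
    ← Complex.isConservativeOn_and_continuousOn_iff_isDifferentiableOn isOpen_univ]
  refine ⟨fun z w _ => ?_, hc.continuousOn⟩
  -- Morera: an arbitrary rectangle is the signed difference of two rectangles based on the axis,
  -- and the integrals along the axis cancel.
  rw [← add_eq_zero_iff_eq_neg, Complex.wedgeIntegral_add_wedgeIntegral_eq]
  have h1 := key z.re z.im w.im
  have h2 := key w.re z.im w.im
  have e1 := intervalIntegral.integral_interval_sub_left (hi z.im 0 w.re) (hi z.im 0 z.re)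
  have e2 := intervalIntegral.integral_interval_sub_left (hi w.im 0 w.re) (hi w.im 0 z.re)
  rw [← e1, ← e2]
  linear_combination h2 - h1

/-- Functions on the two closed half planes that are holomorphic inside and agree on the common
boundary are restrictions of one entire function. -/
theorem exists_entire_of_eq_on_imaginary_axis {f g : ℂ → ℂ}
    (hfc : ContinuousOn f {s | 0 ≤ s.re}) (hfd : DifferentiableOn ℂ f {s | 0 < s.re})
    (hgc : ContinuousOn g {s | s.re ≤ 0}) (hgd : DifferentiableOn ℂ g {s | s.re < 0})
    (heq : ∀ s : ℂ, s.re = 0 → f s = g s) :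
    ∃ F : ℂ → ℂ, Differentiable ℂ F ∧ (∀ s : ℂ, 0 ≤ s.re → F s = f s) ∧
      ∀ s : ℂ, s.re ≤ 0 → F s = g s := by
  classical
  let F : ℂ → ℂ := fun s => if 0 ≤ s.re then f s else g s
  have hF1 : ∀ s : ℂ, 0 ≤ s.re → F s = f s := fun s hs => if_pos hs
  have hF2 : ∀ s : ℂ, s.re ≤ 0 → F s = g s := fun s hs => by
    rcases hs.lt_or_eq with h | h
    · exact if_neg (not_le.2 h)
    · rw [hF1 s h.ge, heq s h]
  refine ⟨F, differentiable_of_continuous_of_off_imaginary_axis ?_ ?_ ?_, hF1, hF2⟩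
  · rw [← continuousOn_univ]
    have : (Set.univ : Set ℂ) = {s | 0 ≤ s.re} ∪ {s | s.re ≤ 0} := by
      ext s; simpa using le_total 0 s.re
    rw [this]
    exact (hfc.congr hF1).union_of_isClosed (hgc.congr hF2)
      (isClosed_le continuous_const Complex.continuous_re)
      (isClosed_le Complex.continuous_re continuous_const)
  · exact hfd.congr fun s hs => hF1 s (le_of_lt hs)
  · exact hgd.congr fun s hs => hF2 s (le_of_lt hs)

/-- Extended Liouville theorem. -/
theorem exists_polyC_of_growth {f : ℂ → ℂ} (hf : Differentiable ℂ f) {c : ℝ} {d : ℕ}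
    (hb : ∀ s, ‖f s‖ ≤ c * (1 + ‖s‖) ^ d) :
    ∃ C : Fin (d + 1) → ℂ, ∀ s, f s = polyC C s := by
  have hc : 0 ≤ c := by simpa using (norm_nonneg _).trans (hb 0)
  have hz : ∀ n, d < n → iteratedDeriv n f 0 = 0 := by
    intro n hn
    -- Cauchy's estimate on the circle of radius R = k + 1, where 1 + ‖z‖ ≤ 2R. It leaves R^(d-n) ≤
    -- 1/R.
    have hle : ∀ k : ℕ, ‖iteratedDeriv n f 0‖ ≤ (n.factorial * (c * 2 ^ d)) * (1 / ((k : ℝ) + 1)) := by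
      intro k
      have hR : (1 : ℝ) ≤ (k : ℝ) + 1 := by linarith [(Nat.cast_nonneg k : (0 : ℝ) ≤ k)]
      have hR0 : (0 : ℝ) < (k : ℝ) + 1 := by linarith
      refine (Complex.norm_iteratedDeriv_le_of_forall_mem_sphere_norm_le n hR0
        hf.diffContOnCl (C := c * (2 * ((k : ℝ) + 1)) ^ d) fun z hz => ?_).trans ?_
      · have hz' : ‖z‖ = (k : ℝ) + 1 := by simpa using hz
        refine (hb z).trans ?_
        rw [hz']
        gcongr
        linarith
      · obtain ⟨e, rfl⟩ := Nat.exists_eq_add_of_lt hn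
        have h1 : (1 : ℝ) ≤ ((k : ℝ) + 1) ^ e := one_le_pow₀ hR
        rw [mul_pow, div_le_iff₀ (by positivity)]
        have : ((k : ℝ) + 1) ^ (d + e + 1) = ((k : ℝ) + 1) ^ d * ((k : ℝ) + 1) ^ e * ((k : ℝ) + 1) := by
          ring
        rw [this]
        have : ((d + e + 1).factorial : ℝ) * (c * 2 ^ d) * (1 / ((k : ℝ) + 1))
            * (((k : ℝ) + 1) ^ d * ((k : ℝ) + 1) ^ e * ((k : ℝ) + 1))
            = ((d + e + 1).factorial : ℝ) * (c * (2 ^ d * ((k : ℝ) + 1) ^ d)) * ((k : ℝ) + 1) ^ e := by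
          field_simp
        rw [this]
        exact le_mul_of_one_le_right (by positivity) h1
    have ht := tendsto_one_div_add_atTop_nhds_zero_nat.const_mul ((n.factorial : ℝ) * (c * 2 ^ d))
    have := ge_of_tendsto' ht hle
    rw [mul_zero] at this
    exact norm_le_zero_iff.1 this
  refine ⟨fun l => ((l : ℕ).factorial : ℂ)⁻¹ * iteratedDeriv l f 0, fun s => ?_⟩
  rw [← Complex.taylorSeries_eq_of_entire' (c := 0) hf (z := s), polyC,
    tsum_eq_sum (s := Finset.range (d + 1)), Finset.sum_range]
  · simp
  · intro n hn
    rw [hz n (by simpa using hn)]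
    simp

/-! ### Degree bounds, the denominator and interpolation nodes -/

/-- The quotient is the reversed polynomial at 1/s, and the constant coefficient of the reversal is
the leading coefficient. -/
theorem Polynomial.tendsto_eval_div_pow_natDegree (p : Polynomial ℂ) :
    Filter.Tendsto (fun s => p.eval s / s ^ p.natDegree) (Bornology.cobounded ℂ)
      (nhds p.leadingCoeff) := by
  have h1 : Filter.Tendsto (fun s : ℂ => p.reverse.eval s⁻¹) (Bornology.cobounded ℂ)
      (nhds (p.reverse.eval 0)) :=
    (p.reverse.continuous.tendsto 0).comp Filter.tendsto_inv₀_cobounded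
  have h0 : p.reverse.eval 0 = p.leadingCoeff := by
    rw [← Polynomial.coeff_zero_eq_eval_zero, Polynomial.coeff_zero_reverse]
  rw [h0] at h1
  refine h1.congr' ?_
  filter_upwards [Bornology.eventually_ne_cobounded 0] with s hs
  let _ := invertibleOfNonzero hs
  have := Polynomial.eval₂_reverse_mul_pow (RingHom.id ℂ) s p
  simp only [invOf_eq_inv] at this
  rw [eq_div_iff (pow_ne_zero _ hs)]
  exact this

/-- If deg q < deg p, dividing by s^(deg p) and letting s = iy tend to infinity would make the
leading coefficient of p vanish. The axis alone is enough, which is where a characteristic function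
is known to be bounded by 1. -/
theorem Polynomial.natDegree_le_of_norm_eval_le {p q : Polynomial ℂ}
    (h : ∀ s : ℂ, s.re = 0 → ‖p.eval s‖ ≤ ‖q.eval s‖) : p.natDegree ≤ q.natDegree := by
  by_contra! hlt
  have hp : p ≠ 0 := by rintro rfl; simp at hlt
  have hy : Filter.Tendsto (fun y : ℝ => (y : ℂ) * Complex.I) Filter.atTop
      (Bornology.cobounded ℂ) := by
    rw [← tendsto_norm_atTop_iff_cobounded]
    simpa using Filter.tendsto_abs_atTop_atTop
  obtain ⟨e, he⟩ := Nat.exists_eq_add_of_lt hlt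
  have h1 := (p.tendsto_eval_div_pow_natDegree.comp hy).norm
  have h2 := ((q.tendsto_eval_div_pow_natDegree.comp hy).mul
    (((Filter.tendsto_inv₀_cobounded (α := ℂ)).comp hy).pow (e + 1))).norm
  simp only [zero_pow (Nat.succ_ne_zero e), mul_zero, norm_zero] at h2
  have : ‖p.leadingCoeff‖ ≤ 0 := by
    refine le_of_tendsto_of_tendsto' h1 h2 fun y => ?_
    simp only [Function.comp]
    rw [inv_pow, ← div_eq_mul_inv, div_div, ← pow_add, ← add_assoc, ← he, norm_div, norm_div]
    exact div_le_div_of_nonneg_right (h _ (by simp)) (norm_nonneg _)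
  exact hp (Polynomial.leadingCoeff_eq_zero.1 (norm_le_zero_iff.1 this))

theorem Polynomial.exists_norm_eval_le (p : Polynomial ℂ) {d : ℕ} (hd : p.natDegree ≤ d) :
    ∃ c : ℝ, 0 ≤ c ∧ ∀ s, ‖p.eval s‖ ≤ c * (1 + ‖s‖) ^ d := by
  refine ⟨∑ i ∈ Finset.range (p.natDegree + 1), ‖p.coeff i‖, by positivity, fun s => ?_⟩
  rw [Polynomial.eval_eq_sum_range, Finset.sum_mul]
  refine (norm_sum_le _ _).trans (Finset.sum_le_sum fun i hi => ?_)
  rw [norm_mul, norm_pow]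
  have h0 := norm_nonneg s
  gcongr
  calc ‖s‖ ^ i ≤ (1 + ‖s‖) ^ i := by gcongr; linarith
    _ ≤ (1 + ‖s‖) ^ d := by
      apply pow_le_pow_right₀ (by linarith)
      rw [Finset.mem_range] at hi; omega

/-- `D_Y` as a polynomial. -/
noncomputable def denomPoly {L M : ℕ} (t : Fin L → ℂ) (u : Fin M → ℂ) : Polynomial ℂ :=
  (∏ j, (Polynomial.X - Polynomial.C (t j))) * ∏ j, (Polynomial.X - Polynomial.C (u j))

theorem eval_denomPoly {L M : ℕ} (t : Fin L → ℂ) (u : Fin M → ℂ) (s : ℂ) :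
    (denomPoly t u).eval s = denomY t u s := by
  simp [denomPoly, denomY, Polynomial.eval_prod]

theorem natDegree_denomPoly {L M : ℕ} (t : Fin L → ℂ) (u : Fin M → ℂ) :
    (denomPoly t u).natDegree = M + L := by
  rw [denomPoly, Polynomial.Monic.natDegree_mul (Polynomial.monic_prod_X_sub_C _ _)
    (Polynomial.monic_prod_X_sub_C _ _)]
  simp [Polynomial.natDegree_finsetProd_X_sub_C_eq_card, add_comm]

theorem differentiable_denomY {L M : ℕ} (t : Fin L → ℂ) (u : Fin M → ℂ) :
    Differentiable ℂ (denomY t u) := by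
  have : denomY t u = fun s => (denomPoly t u).eval s := funext fun s => (eval_denomPoly t u s).symm
  rw [this]
  exact (denomPoly t u).differentiable

theorem denomY_ne_zero {L M : ℕ} {t : Fin L → ℂ} {u : Fin M → ℂ} (ht : ∀ j, 0 < (t j).re)
    (hu : ∀ j, (u j).re < 0) {s : ℂ} (hs : s.re = 0) : denomY t u s ≠ 0 := by
  refine mul_ne_zero (Finset.prod_ne_zero_iff.2 fun j _ h => ?_)
    (Finset.prod_ne_zero_iff.2 fun j _ h => ?_)
  · have := ht j
    rw [← sub_eq_zero.1 h, hs] at this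
    exact lt_irrefl _ this
  · have := hu j
    rw [← sub_eq_zero.1 h, hs] at this
    exact lt_irrefl _ this

theorem denomY_left {L M : ℕ} (t : Fin L → ℂ) (u : Fin M → ℂ) (j : Fin L) :
    denomY t u (t j) = 0 := by
  rw [denomY, Finset.prod_eq_zero (Finset.mem_univ j) (sub_self _), zero_mul]

theorem denomY_right {L M : ℕ} (t : Fin L → ℂ) (u : Fin M → ℂ) (j : Fin M) :
    denomY t u (u j) = 0 := by
  rw [denomY, Finset.prod_eq_zero (f := fun i => u j - u i) (Finset.mem_univ j) (sub_self _),
    mul_zero]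

theorem polyC_zero_arg {d : ℕ} (C : Fin (d + 1) → ℂ) : polyC C 0 = C 0 := by
  rw [polyC, Fin.sum_univ_succ]
  simp

/-- Coefficients are determined by the values at `d + 1` distinct points, here `0`, the `t_j` and
the `u_j`. -/
theorem polyC_injective_of_nodes {L M : ℕ} {t : Fin L → ℂ} {u : Fin M → ℂ}
    (ht : ∀ j, 0 < (t j).re) (hu : ∀ j, (u j).re < 0)
    (htinj : Function.Injective t) (huinj : Function.Injective u) {C C' : Fin (M + L + 1) → ℂ}
    (h0 : C' 0 = C 0) (hT : ∀ j, polyC C' (t j) = polyC C (t j))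
    (hU : ∀ j, polyC C' (u j) = polyC C (u j)) : C' = C := by
  let p : Polynomial ℂ := ∑ l : Fin (M + L + 1), Polynomial.monomial (l : ℕ) (C' l - C l)
  have hp : ∀ s, p.eval s = polyC C' s - polyC C s := by
    intro s
    simp [p, Polynomial.eval_finsetSum, polyC, Finset.sum_sub_distrib]
  -- The nodes 0, t_j, u_j: the real parts are zero, positive and negative, so the three groups
  -- cannot collide. There are M + L + 1 of them, one more than the degree bound for p.
  let f : Option (Fin L ⊕ Fin M) → ℂ := fun o => o.elim 0 (Sum.elim t u)
  have hf : Function.Injective f := by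
    have e : ∀ o, (f o).re = o.elim 0 (Sum.elim (fun j => (t j).re) fun j => (u j).re) := by
      rintro (_ | _ | _) <;> simp [f]
    rintro (_ | i | i) (_ | j | j) h
    · rfl
    · have := congrArg Complex.re h; rw [e, e] at this; exact absurd this (ht j).ne
    · have := congrArg Complex.re h; rw [e, e] at this; exact absurd this (hu j).ne'
    · have := congrArg Complex.re h; rw [e, e] at this; exact absurd this (ht i).ne'
    · rw [htinj h]
    · have := congrArg Complex.re h; rw [e, e] at this
      exact absurd this ((hu j).trans (ht i)).ne'
    · have := congrArg Complex.re h; rw [e, e] at this; exact absurd this (hu i).ne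
    · have := congrArg Complex.re h; rw [e, e] at this
      exact absurd this ((hu i).trans (ht j)).ne
    · rw [huinj h]
  have hp0 : p = 0 := by
    refine Polynomial.eq_zero_of_natDegree_lt_card_of_eval_eq_zero p hf ?_ ?_
    · rintro (_ | j | j)
      · simp [f, hp, polyC_zero_arg, h0]
      · simp [f, hp, hT]
      · simp [f, hp, hU]
    · have : p.natDegree ≤ M + L := Polynomial.natDegree_sum_le_of_forall_le _ _ fun l _ =>
        (Polynomial.natDegree_monomial_le _).trans (Nat.lt_succ_iff.1 l.2)
      simp only [Fintype.card_option, Fintype.card_sum, Fintype.card_fin]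
      omega
  funext l
  have := congrArg (fun q => Polynomial.coeff q (l : ℕ)) hp0
  simp only [p, Polynomial.finsetSum_coeff, Polynomial.coeff_monomial, Polynomial.coeff_zero,
    Fin.val_inj] at this
  simpa [sub_eq_zero] using this

/-! ### Lattice paths and the recursive weights -/

theorem IsLatticePath.monotone {n i j : ℕ} {c : Fin (n + 1) → ℕ × ℕ} (h : IsLatticePath n i j c) :
    Monotone c := by
  refine Fin.monotone_iff_le_succ.2 fun l => ?_
  rcases h.2.2 l with h | h <;> rw [h] <;> exact le_self_add

/-- The box in the definition only provides finiteness: a path is monotone, so all its points lie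
below its end point. -/
theorem mem_latticePaths {n i j : ℕ} {c : Fin (n + 1) → ℕ × ℕ} :
    c ∈ latticePaths n i j ↔ IsLatticePath n i j c := by
  classical
  simp only [latticePaths, Finset.mem_filter, Fintype.mem_piFinset, and_iff_right_iff_imp]
  intro h l
  have := h.monotone (Fin.le_last l)
  rw [h.2.1] at this
  simpa [Nat.lt_succ_iff, Prod.le_def] using this

theorem isLatticePath_zero {i j : ℕ} {c : Fin 1 → ℕ × ℕ} :
    IsLatticePath 0 i j c ↔ c 0 = (0, 0) ∧ (i, j) = (0, 0) := by
  simp only [IsLatticePath, IsEmpty.forall_iff, and_true]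
  constructor
  · rintro ⟨h0, h1⟩
    exact ⟨h0, by rw [← h1, ← h0]; rfl⟩
  · rintro ⟨h0, h1⟩
    exact ⟨h0, by rw [h1, ← h0]; rfl⟩

/-- Splitting off the last step of a lattice path. -/
theorem isLatticePath_succ {n i j : ℕ} {c : Fin (n + 2) → ℕ × ℕ} :
    IsLatticePath (n + 1) i j c ↔ c (Fin.last _) = (i, j) ∧
      ((∃ i', i = i' + 1 ∧ IsLatticePath n i' j (Fin.init c)) ∨
        ∃ j', j = j' + 1 ∧ IsLatticePath n i j' (Fin.init c)) := by
  constructor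
  · rintro ⟨h0, h1, h2⟩
    refine ⟨h1, ?_⟩
    have hstep : ∀ l : Fin n, Fin.init c l.succ = Fin.init c l.castSucc + (1, 0) ∨
        Fin.init c l.succ = Fin.init c l.castSucc + (0, 1) := fun l => h2 l.castSucc
    have hl := h2 (Fin.last n)
    rw [Fin.succ_last, h1] at hl
    rcases hq : c (Fin.last n).castSucc with ⟨i', j'⟩
    rw [hq] at hl
    rcases hl with hl | hl
    · simp only [Prod.mk_add_mk, add_zero, Prod.mk.injEq] at hl
      obtain ⟨rfl, rfl⟩ := hl
      exact Or.inl ⟨i', rfl, h0, hq, hstep⟩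
    · simp only [Prod.mk_add_mk, add_zero, Prod.mk.injEq] at hl
      obtain ⟨rfl, rfl⟩ := hl
      exact Or.inr ⟨j', rfl, h0, hq, hstep⟩
  · rintro ⟨h1, ⟨i', rfl, h0, hq, hstep⟩ | ⟨j', rfl, h0, hq, hstep⟩⟩
    · refine ⟨h0, h1, fun l => ?_⟩
      induction l using Fin.lastCases with
      | last =>
        left
        have : c (Fin.last n).castSucc = (i', j) := hq
        rw [Fin.succ_last, h1, this]; simp
      | cast l => exact hstep l
    · refine ⟨h0, h1, fun l => ?_⟩
      induction l using Fin.lastCases with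
      | last =>
        right
        have : c (Fin.last n).castSucc = (i, j') := hq
        rw [Fin.succ_last, h1, this]; simp
      | cast l => exact hstep l

/-- Appending an end point. -/
def snocEmb (n : ℕ) (q : ℕ × ℕ) : (Fin (n + 1) → ℕ × ℕ) ↪ (Fin (n + 2) → ℕ × ℕ) :=
  ⟨fun c => Fin.snoc (α := fun _ => ℕ × ℕ) c q, fun c c' h => by
    have := congrArg (fun d => Fin.init (α := fun _ => ℕ × ℕ) d) h
    simpa using this⟩

theorem init_snocEmb (n : ℕ) (q : ℕ × ℕ) (c : Fin (n + 1) → ℕ × ℕ) :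
    (Fin.init (snocEmb n q c) : Fin (n + 1) → ℕ × ℕ) = c :=
  Fin.init_snoc (α := fun _ => ℕ × ℕ) q c

theorem snocEmb_last (n : ℕ) (q : ℕ × ℕ) (c : Fin (n + 1) → ℕ × ℕ) :
    snocEmb n q c (Fin.last _) = q :=
  Fin.snoc_last (α := fun _ => ℕ × ℕ) q c

theorem eq_snocEmb {n : ℕ} {q : ℕ × ℕ} {c : Fin (n + 2) → ℕ × ℕ} (h : c (Fin.last _) = q) :
    snocEmb n q (Fin.init c) = c := by
  subst h
  exact Fin.snoc_init_self c

/-- Paths are sorted by their penultimate point, which differs between the two classes. The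
existential supplies the disjointness proof that `disjUnion` takes as an argument. -/
theorem latticePaths_succ_succ (n i j : ℕ) :
    ∃ h, latticePaths (n + 1) (i + 1) (j + 1) =
      ((latticePaths n i (j + 1)).map (snocEmb n (i + 1, j + 1))).disjUnion
        ((latticePaths n (i + 1) j).map (snocEmb n (i + 1, j + 1))) h := by
  refine ⟨?_, ?_⟩
  · rw [Finset.disjoint_map, Finset.disjoint_left]
    intro c h1 h2
    have h1 := (mem_latticePaths.1 h1).2.1
    have h2 := (mem_latticePaths.1 h2).2.1
    rw [h1] at h2
    simp at h2
  · ext c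
    simp only [Finset.mem_disjUnion, Finset.mem_map, mem_latticePaths]
    rw [isLatticePath_succ]
    constructor
    · rintro ⟨h1, ⟨i', h, hc⟩ | ⟨j', h, hc⟩⟩
      · obtain rfl : i = i' := by omega
        exact Or.inl ⟨_, hc, eq_snocEmb h1⟩
      · obtain rfl : j = j' := by omega
        exact Or.inr ⟨_, hc, eq_snocEmb h1⟩
    · rintro (⟨c, hc, rfl⟩ | ⟨c, hc, rfl⟩)
      · exact ⟨snocEmb_last _ _ _, Or.inl ⟨i, rfl, by rwa [init_snocEmb]⟩⟩
      · exact ⟨snocEmb_last _ _ _, Or.inr ⟨j, rfl, by rwa [init_snocEmb]⟩⟩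

theorem latticePaths_succ_zero (n i : ℕ) :
    latticePaths (n + 1) (i + 1) 0 = (latticePaths n i 0).map (snocEmb n (i + 1, 0)) := by
  ext c
  simp only [Finset.mem_map, mem_latticePaths]
  rw [isLatticePath_succ]
  constructor
  · rintro ⟨h1, ⟨i', h, hc⟩ | ⟨j', h, hc⟩⟩
    · obtain rfl : i = i' := by omega
      exact ⟨_, hc, eq_snocEmb h1⟩
    · omega
  · rintro ⟨c, hc, rfl⟩
    exact ⟨snocEmb_last _ _ _, Or.inl ⟨i, rfl, by rwa [init_snocEmb]⟩⟩

theorem latticePaths_zero_succ (n j : ℕ) :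
    latticePaths (n + 1) 0 (j + 1) = (latticePaths n 0 j).map (snocEmb n (0, j + 1)) := by
  ext c
  simp only [Finset.mem_map, mem_latticePaths]
  rw [isLatticePath_succ]
  constructor
  · rintro ⟨h1, ⟨i', h, hc⟩ | ⟨j', h, hc⟩⟩
    · omega
    · obtain rfl : j = j' := by omega
      exact ⟨_, hc, eq_snocEmb h1⟩
  · rintro ⟨c, hc, rfl⟩
    exact ⟨snocEmb_last _ _ _, Or.inr ⟨j, rfl, by rwa [init_snocEmb]⟩⟩

theorem latticePaths_zero : latticePaths 0 0 0 = {fun _ => (0, 0)} := by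
  ext c
  rw [mem_latticePaths, isLatticePath_zero, Finset.mem_singleton]
  constructor
  · rintro ⟨h, -⟩
    funext l
    rw [Fin.fin_one_eq_zero l, h]
  · rintro rfl
    exact ⟨rfl, rfl⟩

theorem pathWeight_succ (K : ℂ → ℂ) (a : ℝ) (y : ℕ → ℝ) (s : ℂ) {n i j : ℕ}
    {c : Fin (n + 2) → ℕ × ℕ} (h : IsLatticePath n i j (Fin.init c)) :
    pathWeight K a y s c = pathWeight K a y s (Fin.init c : Fin (n + 1) → ℕ × ℕ)
      * K (scaled a y i j s) := by
  rw [pathWeight, Fin.prod_univ_castSucc, pathWeight]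
  have : c (Fin.last n).castSucc = (i, j) := h.2.1
  rw [this]
  rfl

theorem sum_snocEmb_pathWeight (K : ℂ → ℂ) (a : ℝ) (y : ℕ → ℝ) (s : ℂ) (n i j : ℕ) (q : ℕ × ℕ) :
    ∑ c ∈ (latticePaths n i j).map (snocEmb n q), pathWeight K a y s c
      = (∑ c ∈ latticePaths n i j, pathWeight K a y s c) * K (scaled a y i j s) := by
  rw [Finset.sum_map, Finset.sum_mul]
  refine Finset.sum_congr rfl fun c hc => ?_
  rw [mem_latticePaths] at hc
  rw [pathWeight_succ (i := i) (j := j) K a y s (by rwa [init_snocEmb]), init_snocEmb]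

/-- Induction on the number of steps. Since the path weight omits the end point, removing the last
step removes exactly the factor K at the penultimate point, as in the recursion for G. -/
theorem weightG_eq_sum_of_add_eq (K : ℂ → ℂ) (a : ℝ) (y : ℕ → ℝ) (s : ℂ) (n : ℕ) :
    ∀ i j : ℕ, i + j = n →
      weightG K a y s i j = ∑ c ∈ latticePaths n i j, pathWeight K a y s c := by
  induction n with
  | zero =>
    intro i j h
    obtain ⟨rfl, rfl⟩ : i = 0 ∧ j = 0 := by omega
    rw [latticePaths_zero]
    simp [weightG, pathWeight]
  | succ n ih =>
    rintro (_ | i) (_ | j) h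
    · omega
    · rw [latticePaths_zero_succ, sum_snocEmb_pathWeight, ← ih 0 j (by omega), weightG]
    · rw [latticePaths_succ_zero, sum_snocEmb_pathWeight, ← ih i 0 (by omega), weightG]
    · obtain ⟨hd, he⟩ := latticePaths_succ_succ n i j
      rw [he, Finset.sum_disjUnion, sum_snocEmb_pathWeight, sum_snocEmb_pathWeight,
        ← ih i (j + 1) (by omega), ← ih (i + 1) j (by omega), weightG]

theorem weightG_eq_sum (K : ℂ → ℂ) (a : ℝ) (y : ℕ → ℝ) (s : ℂ) (i j : ℕ) :
    weightG K a y s i j = ∑ c ∈ latticePaths (i + j) i j, pathWeight K a y s c :=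
  weightG_eq_sum_of_add_eq K a y s _ i j rfl

/-- For K = 1 the recursion is Pascal's rule. Every path then has weight one, so this counts the
lattice paths. -/
theorem weightG_one (a : ℝ) (y : ℕ → ℝ) (s : ℂ) (n : ℕ) :
    ∀ i j : ℕ, i + j = n → weightG (fun _ => 1) a y s i j = (n.choose i : ℕ) := by
  induction n with
  | zero =>
    intro i j h
    obtain ⟨rfl, rfl⟩ : i = 0 ∧ j = 0 := by omega
    simp [weightG]
  | succ n ih =>
    rintro (_ | i) (_ | j) h
    · omega
    · rw [weightG, ih 0 j (by omega)]; simp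
    · obtain rfl : i = n := by omega
      rw [weightG, ih i 0 (by omega)]; simp
    · rw [weightG, ih i (j + 1) (by omega), ih (i + 1) j (by omega), Nat.choose_succ_succ]
      simp

theorem card_latticePaths (i j : ℕ) : (latticePaths (i + j) i j).card = (i + j).choose i := by
  have h := weightG_eq_sum (fun _ => 1) 0 0 0 i j
  rw [weightG_one 0 0 0 (i + j) i j rfl] at h
  simp only [pathWeight, Finset.prod_const_one, Finset.sum_const, nsmul_eq_mul, mul_one] at h
  exact_mod_cast h.symm

/-! ### Laplace transforms and their generating functions -/

theorem norm_exp_neg_mul_ofReal (s : ℂ) (x : ℝ) :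
    ‖Complex.exp (-s * (x : ℂ))‖ = Real.exp (-(s.re * x)) := by
  rw [Complex.norm_exp]; simp

theorem norm_exp_neg_mul_ofReal_le_one {s : ℂ} {x : ℝ} (h : 0 ≤ s.re * x) :
    ‖Complex.exp (-s * (x : ℂ))‖ ≤ 1 := by
  rw [norm_exp_neg_mul_ofReal]
  exact Real.exp_le_one_iff.2 (neg_nonpos.2 h)

section Lst

variable {Ω : Type*} [MeasurableSpace Ω] {Q : Measure Ω} {X : Ω → ℝ} {s : ℂ}

theorem integrable_exp_neg_mul [IsFiniteMeasure Q] (hX : Measurable X)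
    (h : ∀ᵐ ω ∂Q, 0 ≤ s.re * X ω) : Integrable (fun ω => Complex.exp (-s * (X ω : ℂ))) Q :=
  Integrable.of_bound (by fun_prop) 1 (h.mono fun _ h => norm_exp_neg_mul_ofReal_le_one h)

theorem norm_lst_le_one [IsProbabilityMeasure Q] (h : ∀ᵐ ω ∂Q, 0 ≤ s.re * X ω) :
    ‖lst Q X s‖ ≤ 1 := by
  simpa [lst] using norm_integral_le_of_norm_le_const
    (h.mono fun _ h => norm_exp_neg_mul_ofReal_le_one h)

theorem lst_neg (Q : Measure Ω) (X : Ω → ℝ) (s : ℂ) : lst Q (fun ω => -X ω) (-s) = lst Q X s := by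
  simp [lst]

theorem lst_map {f : Ω → ℝ} (hf : Measurable f) (s : ℂ) :
    ∫ x, Complex.exp (-s * (x : ℂ)) ∂(Q.map f) = lst Q f s := by
  rw [lst, integral_map hf.aemeasurable (by fun_prop)]

theorem continuousOn_lst [IsFiniteMeasure Q] (hX : Measurable X) (h : ∀ᵐ ω ∂Q, 0 ≤ X ω) :
    ContinuousOn (lst Q X) {s | 0 ≤ s.re} := by
  refine continuousOn_of_dominated (bound := fun _ => 1) (fun s _ => by fun_prop)
    (fun s hs => h.mono fun ω hω => norm_exp_neg_mul_ofReal_le_one (mul_nonneg hs hω))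
    (integrable_const _) (Filter.Eventually.of_forall fun ω => by fun_prop)

/-- The transform is the complex moment generating function at -s, which is holomorphic over the
interior of the set of exponents with finite moment. For X ≥ 0 that set contains (-∞, 0]. -/
theorem differentiableOn_lst [IsFiniteMeasure Q] (hX : Measurable X) (h : ∀ᵐ ω ∂Q, 0 ≤ X ω) :
    DifferentiableOn ℂ (lst Q X) {s | 0 < s.re} := by
  have hsub : Set.Iic (0 : ℝ) ⊆ integrableExpSet X Q := by
    intro x hx
    refine Integrable.of_bound (by fun_prop) 1 (h.mono fun ω hω => ?_)
    rw [Real.norm_eq_abs, Real.abs_exp]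
    exact Real.exp_le_one_iff.2 (mul_nonpos_of_nonpos_of_nonneg hx hω)
  have hint : Set.Iio (0 : ℝ) ⊆ interior (integrableExpSet X Q) := by
    rw [← interior_Iic]
    exact interior_mono hsub
  have hd := (differentiableOn_complexMGF (X := X) (μ := Q)).comp
    (differentiable_neg.differentiableOn (s := {s : ℂ | 0 < s.re})) (fun s hs => hint (by
      simpa using hs))
  exact hd

end Lst

/-- The generating function `∑ rⁿ E (exp (-s X_n))`. -/
noncomputable def genLst {Ω : Type*} [MeasurableSpace Ω] (Q : Measure Ω) (X : ℕ → Ω → ℝ) (r : ℝ) (s : ℂ) : ℂ :=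
  ∑' n : ℕ, (r : ℂ) ^ n * lst Q (X n) s

section GenLst

variable {Ω : Type*} [MeasurableSpace Ω] {Q : Measure Ω} [IsProbabilityMeasure Q]
  {X : ℕ → Ω → ℝ} {r : ℝ} {s : ℂ}

theorem norm_pow_mul_lst_le (hr₀ : 0 ≤ r) (h : ∀ n, ∀ᵐ ω ∂Q, 0 ≤ s.re * X n ω) (n : ℕ) :
    ‖(r : ℂ) ^ n * lst Q (X n) s‖ ≤ r ^ n := by
  rw [norm_mul, norm_pow, Complex.norm_real, Real.norm_of_nonneg hr₀]
  exact mul_le_of_le_one_right (by positivity) (norm_lst_le_one (h n))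

theorem hasSum_genLst (hr₀ : 0 ≤ r) (hr₁ : r < 1) (h : ∀ n, ∀ᵐ ω ∂Q, 0 ≤ s.re * X n ω) :
    HasSum (fun n : ℕ => (r : ℂ) ^ n * lst Q (X n) s) (genLst Q X r s) :=
  (Summable.of_norm_bounded (summable_geometric_of_lt_one hr₀ hr₁)
    (norm_pow_mul_lst_le hr₀ h)).hasSum

theorem norm_genLst_le (hr₀ : 0 ≤ r) (hr₁ : r < 1) (h : ∀ n, ∀ᵐ ω ∂Q, 0 ≤ s.re * X n ω) :
    ‖genLst Q X r s‖ ≤ (1 - r)⁻¹ :=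
  tsum_of_norm_bounded (hasSum_geometric_of_lt_one hr₀ hr₁) (norm_pow_mul_lst_le hr₀ h)

theorem continuousOn_genLst (hr₀ : 0 ≤ r) (hr₁ : r < 1) (hX : ∀ n, Measurable (X n))
    (h : ∀ n, ∀ᵐ ω ∂Q, 0 ≤ X n ω) : ContinuousOn (genLst Q X r) {s | 0 ≤ s.re} :=
  continuousOn_tsum (fun n => continuousOn_const.mul (continuousOn_lst (hX n) (h n)))
    (summable_geometric_of_lt_one hr₀ hr₁)
    fun n _ hs => norm_pow_mul_lst_le hr₀ (fun n => (h n).mono fun _ => mul_nonneg hs) n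

theorem differentiableOn_genLst (hr₀ : 0 ≤ r) (hr₁ : r < 1) (hX : ∀ n, Measurable (X n))
    (h : ∀ n, ∀ᵐ ω ∂Q, 0 ≤ X n ω) : DifferentiableOn ℂ (genLst Q X r) {s | 0 < s.re} :=
  Complex.differentiableOn_tsum_of_summable_norm (summable_geometric_of_lt_one hr₀ hr₁)
    (fun n => (differentiableOn_const _).mul (differentiableOn_lst (hX n) (h n)))
    (isOpen_lt continuous_const Complex.continuous_re)
    fun n _ hs => norm_pow_mul_lst_le hr₀
      (fun n => (h n).mono fun _ => mul_nonneg (le_of_lt hs)) n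

/-- This reflection carries the results for nonnegative variables on the right half plane to
nonpositive variables on the left one. -/
theorem genLst_neg (Q : Measure Ω) (X : ℕ → Ω → ℝ) (r : ℝ) (s : ℂ) :
    genLst Q (fun n ω => -X n ω) r (-s) = genLst Q X r s := by
  simp [genLst, lst_neg]

theorem continuousOn_genLst_of_nonpos (hr₀ : 0 ≤ r) (hr₁ : r < 1) (hX : ∀ n, Measurable (X n))
    (h : ∀ n, ∀ᵐ ω ∂Q, X n ω ≤ 0) : ContinuousOn (genLst Q X r) {s | s.re ≤ 0} := by
  have := (continuousOn_genLst hr₀ hr₁ (fun n => (hX n).neg)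
    (fun n => (h n).mono fun _ => neg_nonneg.2)).comp (continuous_neg.continuousOn
      (s := {s : ℂ | s.re ≤ 0})) fun s hs => by simpa using hs
  exact this.congr fun s _ => (genLst_neg Q X r s).symm

theorem differentiableOn_genLst_of_nonpos (hr₀ : 0 ≤ r) (hr₁ : r < 1) (hX : ∀ n, Measurable (X n))
    (h : ∀ n, ∀ᵐ ω ∂Q, X n ω ≤ 0) : DifferentiableOn ℂ (genLst Q X r) {s | s.re < 0} := by
  have := (differentiableOn_genLst hr₀ hr₁ (fun n => (hX n).neg)
    (fun n => (h n).mono fun _ => neg_nonneg.2)).comp (differentiable_neg.differentiableOn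
      (s := {s : ℂ | s.re < 0})) fun s hs => by simpa using hs
  exact this.congr fun s _ => (genLst_neg Q X r s).symm

end GenLst

/-! ### Transforms averaged over a random multiplier -/

section Mixture

variable {Ω : Type*} [MeasurableSpace Ω] {Q : Measure Ω} {s : ℂ} {μ : Measure ℝ}

theorem ae_prod_re_mul_nonneg {X : Ω → ℝ} (h0 : ∀ ω, 0 ≤ X ω) (h : ∀ᵐ y ∂μ, 0 ≤ s.re * y) :
    ∀ᵐ p ∂(μ.prod Q), 0 ≤ s.re * (p.1 * X p.2) := by
  filter_upwards [Measure.quasiMeasurePreserving_fst.ae h] with p hp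
  rw [← mul_assoc]
  exact mul_nonneg hp (h0 _)

variable [IsProbabilityMeasure Q] [IsFiniteMeasure μ]

theorem lst_mul_ofReal (Q : Measure Ω) (X : Ω → ℝ) (s : ℂ) (y : ℝ) :
    lst Q X (s * (y : ℂ)) = ∫ ω, Complex.exp (-s * ((y * X ω : ℝ) : ℂ)) ∂Q := by
  simp [lst, mul_assoc]

theorem integrable_lst_mul {X : Ω → ℝ} (hX : Measurable X) (h0 : ∀ ω, 0 ≤ X ω)
    (h : ∀ᵐ y ∂μ, 0 ≤ s.re * y) : Integrable (fun y : ℝ => lst Q X (s * (y : ℂ))) μ := by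
  simp only [lst_mul_ofReal]
  exact (integrable_exp_neg_mul (Q := μ.prod Q) (by fun_prop)
    (ae_prod_re_mul_nonneg h0 h)).integral_prod_left

theorem integral_lst_mul {X : Ω → ℝ} (hX : Measurable X) (h0 : ∀ ω, 0 ≤ X ω)
    (h : ∀ᵐ y ∂μ, 0 ≤ s.re * y) :
    ∫ y : ℝ, lst Q X (s * (y : ℂ)) ∂μ = lst (μ.prod Q) (fun p => p.1 * X p.2) s := by
  simp only [lst_mul_ofReal]
  exact (integral_prod _ (integrable_exp_neg_mul (Q := μ.prod Q) (by fun_prop)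
    (ae_prod_re_mul_nonneg h0 h))).symm

/-- Averaging over y is again a transform, namely that of y X_n on the product space. Boundedness,
continuity and holomorphy of the averaged function thus come from the general results on `genLst`.
-/
theorem integral_genLst_mul [IsProbabilityMeasure μ] {X : ℕ → Ω → ℝ} {r : ℝ} (hr₀ : 0 ≤ r)
    (hr₁ : r < 1) (hX : ∀ n, Measurable (X n)) (h0 : ∀ n ω, 0 ≤ X n ω)
    (h : ∀ᵐ y ∂μ, 0 ≤ s.re * y) :
    ∫ y : ℝ, genLst Q X r (s * (y : ℂ)) ∂μ = genLst (μ.prod Q) (fun n p => p.1 * X n p.2) r s := by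
  have hb : ∀ n, ∀ᵐ y : ℝ ∂μ, ‖(r : ℂ) ^ n * lst Q (X n) (s * (y : ℂ))‖ ≤ r ^ n := fun n => by
    filter_upwards [h] with y hy
    exact norm_pow_mul_lst_le hr₀ (fun n => Filter.Eventually.of_forall fun ω => by
      simpa using mul_nonneg hy (h0 n ω)) n
  have := hasSum_integral_of_summable_integral_norm (μ := μ)
    (F := fun (n : ℕ) (y : ℝ) => (r : ℂ) ^ n * lst Q (X n) (s * (y : ℂ)))
    (fun n => (integrable_lst_mul (hX n) (h0 n) h).const_mul _)
    (Summable.of_nonneg_of_le (fun n => integral_nonneg fun _ => norm_nonneg _)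
      (fun n => by
        simpa using integral_mono_of_nonneg (Filter.Eventually.of_forall fun _ => norm_nonneg _)
          (integrable_const _) (hb n)) (summable_geometric_of_lt_one hr₀ hr₁))
  unfold genLst
  rw [← this.tsum_eq]
  refine tsum_congr fun n => ?_
  rw [integral_const_mul, integral_lst_mul (hX n) (h0 n) h]

end Mixture

/-! ### The recursion, independence and the one-step identity -/

section Waiting

variable {Ω : Type*} {w : ℝ} {V B A : ℕ → Ω → ℝ}

theorem waiting_nonneg (hw : 0 ≤ w) (n : ℕ) (ω : Ω) : 0 ≤ waiting w V B A n ω := by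
  cases n with
  | zero => exact hw
  | succ n => exact le_max_right _ _

theorem measurable_waiting [MeasurableSpace Ω] (hV : ∀ n, Measurable (V n))
    (hB : ∀ n, Measurable (B n)) (hA : ∀ n, Measurable (A n)) (n : ℕ) :
    Measurable (waiting w V B A n) := by
  induction n with
  | zero => exact measurable_const
  | succ n ih =>
    have h1 := hV n
    have h2 := hB n
    have h3 := hA n
    simp only [waiting]
    fun_prop

/-- `W_n` is determined by `V_k` and `B_k - A_k` for `k < n`. -/
theorem waiting_congr {Ω' : Type*} {V' B' A' : ℕ → Ω' → ℝ} {ω : Ω} {ω' : Ω'} {n : ℕ}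
    (hV : ∀ k < n, V k ω = V' k ω') (hY : ∀ k < n, B k ω - A k ω = B' k ω' - A' k ω') :
    waiting w V B A n ω = waiting w V' B' A' n ω' := by
  induction n with
  | zero => rfl
  | succ n ih =>
    simp only [waiting]
    rw [ih (fun k hk => hV k (by omega)) fun k hk => hY k (by omega), add_sub_assoc,
      add_sub_assoc, hV n (by omega), hY n (by omega)]

/-- `W_n` as a measurable function of the variables with index in `S`, if these include all
`V_k` and `Y_k` with `k < n`. -/
theorem exists_waiting_eq_comp (S : Finset (ℕ ⊕ ℕ)) {n : ℕ}
    (hS : ∀ k < n, Sum.inl k ∈ S ∧ Sum.inr k ∈ S) :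
    ∃ g : (S → ℝ) → ℝ, Measurable g ∧ waiting w V B A n =
      g ∘ fun ω (i : S) => (Sum.elim V fun n ω => B n ω - A n ω) i ω := by
  classical
  let V' : ℕ → (S → ℝ) → ℝ := fun k x => if h : Sum.inl k ∈ S then x ⟨_, h⟩ else 0
  let B' : ℕ → (S → ℝ) → ℝ := fun k x => if h : Sum.inr k ∈ S then x ⟨_, h⟩ else 0
  have hV' : ∀ k, Measurable (V' k) := fun k => by
    by_cases h : Sum.inl k ∈ S
    · simpa only [V', h, dite_true] using measurable_pi_apply _
    · simpa only [V', h, dite_false] using measurable_const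
  have hB' : ∀ k, Measurable (B' k) := fun k => by
    by_cases h : Sum.inr k ∈ S
    · simpa only [B', h, dite_true] using measurable_pi_apply _
    · simpa only [B', h, dite_false] using measurable_const
  refine ⟨waiting w V' B' (fun _ _ => 0) n,
    measurable_waiting hV' hB' (fun _ => measurable_const) n, funext fun ω => ?_⟩
  refine waiting_congr (fun k hk => ?_) fun k hk => ?_
  · simp [V', (hS k hk).1]
  · simp [B', (hS k hk).2]

variable [MeasurableSpace Ω] {P : Measure Ω}

/-- W_n is a function of the variables with index below n, and disjoint blocks of an independent
family are independent. For the second claim V_n joins the first block. -/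
theorem indepFun_waiting (hVm : ∀ n, Measurable (V n)) (hBm : ∀ n, Measurable (B n))
    (hAm : ∀ n, Measurable (A n)) (hind : iIndepFun (Sum.elim V fun n ω => B n ω - A n ω) P)
    (n : ℕ) : IndepFun (V n) (waiting w V B A n) P ∧
      IndepFun (fun ω => V n ω * waiting w V B A n ω) (fun ω => B n ω - A n ω) P := by
  classical
  have hm : ∀ i, Measurable ((Sum.elim V fun n ω => B n ω - A n ω) i) := by
    rintro (i | i)
    · exact hVm i
    · exact (hBm i).sub (hAm i)
  let S : Finset (ℕ ⊕ ℕ) := (Finset.range n).disjSum (Finset.range n)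
  have hS : ∀ k < n, Sum.inl k ∈ S ∧ Sum.inr k ∈ S := fun k hk => by simp [S, hk]
  constructor
  · obtain ⟨g, hg, he⟩ := exists_waiting_eq_comp (w := w) (V := V) (B := B) (A := A) S hS
    have := hind.indepFun_finset {Sum.inl n} S (by simp [S]) hm
    rw [he]
    exact this.comp (measurable_pi_apply (⟨Sum.inl n, by simp⟩ :
      ({Sum.inl n} : Finset (ℕ ⊕ ℕ)))) hg
  · let T : Finset (ℕ ⊕ ℕ) := insert (Sum.inl n) S
    obtain ⟨g, hg, he⟩ := exists_waiting_eq_comp (w := w) (V := V) (B := B) (A := A) T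
      fun k hk => ⟨Finset.mem_insert_of_mem (hS k hk).1, Finset.mem_insert_of_mem (hS k hk).2⟩
    have := hind.indepFun_finset T {Sum.inr n} (by simp [S, T]) hm
    have h2 := this.comp (φ := fun x => x ⟨Sum.inl n, Finset.mem_insert_self _ _⟩ * g x)
      ((measurable_pi_apply _).mul hg)
      (measurable_pi_apply (⟨Sum.inr n, by simp⟩ : ({Sum.inr n} : Finset (ℕ ⊕ ℕ))))
    rw [he]
    exact h2

/-- One of the two parts is x and the other is 0. This is the algebraic source of the splitting
between the half planes. -/
theorem exp_max_add_exp_min (s : ℂ) (x : ℝ) :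
    Complex.exp (-s * ((max x 0 : ℝ) : ℂ)) + Complex.exp (-s * ((min x 0 : ℝ) : ℂ))
      = 1 + Complex.exp (-s * (x : ℂ)) := by
  rcases le_total x 0 with h | h
  · simp [h]
  · simp [h, add_comm]

theorem lst_max_add_lst_min [IsProbabilityMeasure P] {X : Ω → ℝ} (hX : Measurable X) {s : ℂ}
    (hs : s.re = 0) :
    lst P (fun ω => max (X ω) 0) s + lst P (fun ω => min (X ω) 0) s = 1 + lst P X s := by
  have h : ∀ (Y : Ω → ℝ), ∀ᵐ ω ∂P, 0 ≤ s.re * Y ω := fun Y => by simp [hs]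
  unfold lst
  rw [← integral_add (integrable_exp_neg_mul (by fun_prop) (h _))
    (integrable_exp_neg_mul (by fun_prop) (h _))]
  simp only [exp_max_add_exp_min]
  rw [integral_add (integrable_const _) (integrable_exp_neg_mul hX (h _))]
  simp

theorem lst_add_of_indepFun [IsProbabilityMeasure P] {X Y : Ω → ℝ} (hX : Measurable X)
    (hY : Measurable Y) (hXY : IndepFun X Y P) (s : ℂ) :
    lst P (fun ω => X ω + Y ω) s = lst P X s * lst P Y s := by
  have h := hXY.comp (φ := fun x : ℝ => Complex.exp (-s * (x : ℂ)))
    (ψ := fun x : ℝ => Complex.exp (-s * (x : ℂ))) (by fun_prop) (by fun_prop)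
  have := h.integral_mul_eq_mul_integral (by fun_prop) (by fun_prop)
  unfold lst
  simp only [Complex.ofReal_add, mul_add, Complex.exp_add]
  exact this

/-- On the axis the integrand has modulus one, so Fubini applies with no assumption on the signs of
X and Y. -/
theorem lst_mul_of_indepFun [IsProbabilityMeasure P] {X Y : Ω → ℝ} (hX : Measurable X)
    (hY : Measurable Y) (hXY : IndepFun X Y P) {s : ℂ} (hs : s.re = 0) :
    lst P (fun ω => X ω * Y ω) s = ∫ x : ℝ, lst P Y (s * (x : ℂ)) ∂(P.map X) := by
  have : IsProbabilityMeasure (P.map X) := Measure.isProbabilityMeasure_map hX.aemeasurable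
  have : IsProbabilityMeasure (P.map Y) := Measure.isProbabilityMeasure_map hY.aemeasurable
  have h1 : ∀ x : ℝ, lst P Y (s * (x : ℂ))
      = ∫ y : ℝ, Complex.exp (-s * ((x * y : ℝ) : ℂ)) ∂(P.map Y) := fun x => by
    rw [lst_mul_ofReal, integral_map hY.aemeasurable (by fun_prop)]
  simp only [h1]
  rw [← integral_prod (fun p : ℝ × ℝ => Complex.exp (-s * ((p.1 * p.2 : ℝ) : ℂ)))
    (integrable_exp_neg_mul (by fun_prop) (by simp [hs])),
    ← hXY.map_prod_eq_prod_map_map hX.aemeasurable hY.aemeasurable,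
    integral_map (by fun_prop) (by fun_prop)]
  rfl

/-- The one-step relation between the transforms on the imaginary axis. -/
theorem lst_waiting_succ_add [IsProbabilityMeasure P]
    (hVm : ∀ n, Measurable (V n)) (hBm : ∀ n, Measurable (B n)) (hAm : ∀ n, Measurable (A n))
    (hind : iIndepFun (Sum.elim V fun n ω => B n ω - A n ω) P)
    {a p₁ p₂ : ℝ} (hp₁ : 0 ≤ p₁) (hp₂ : 0 ≤ p₂) (hp : p₁ + p₂ ≤ 1)
    {μ ν : Measure ℝ} [IsProbabilityMeasure μ] [IsProbabilityMeasure ν]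
    (hV : ∀ n, P.map (V n) =
      ENNReal.ofReal p₁ • Measure.dirac a + ENNReal.ofReal p₂ • μ
        + ENNReal.ofReal (1 - p₁ - p₂) • ν)
    {η : Measure ℝ} (hY : ∀ n, P.map (fun ω => B n ω - A n ω) = η)
    (hw : 0 ≤ w) {s : ℂ} (hs : s.re = 0) (n : ℕ) :
    lst P (waiting w V B A (n + 1)) s
        + lst P (fun ω => min (V n ω * waiting w V B A n ω + B n ω - A n ω) 0) s
      = 1 + (∫ y, Complex.exp (-s * (y : ℂ)) ∂η) *
        (p₁ * lst P (waiting w V B A n) (a * s)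
          + p₂ * (∫ y : ℝ, lst P (waiting w V B A n) (s * (y : ℂ)) ∂μ)
          + (1 - p₁ - p₂) * ∫ y : ℝ, lst P (waiting w V B A n) (s * (y : ℂ)) ∂ν) := by
  have hW := measurable_waiting (w := w) hVm hBm hAm n
  have hVn := hVm n
  have hBn := hBm n
  have hAn := hAm n
  have h0 : ∀ ω, 0 ≤ waiting w V B A n ω := waiting_nonneg hw n
  obtain ⟨hi1, hi2⟩ := indepFun_waiting (w := w) hVm hBm hAm hind n
  have hI : ∀ (κ : Measure ℝ) [IsFiniteMeasure κ],
      Integrable (fun y : ℝ => lst P (waiting w V B A n) (s * (y : ℂ))) κ :=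
    fun κ _ => integrable_lst_mul hW h0 (by simp [hs])
  have e1 : lst P (fun ω => V n ω * waiting w V B A n ω) s
      = p₁ * lst P (waiting w V B A n) (a * s)
          + p₂ * (∫ y : ℝ, lst P (waiting w V B A n) (s * (y : ℂ)) ∂μ)
          + (1 - p₁ - p₂) * ∫ y : ℝ, lst P (waiting w V B A n) (s * (y : ℂ)) ∂ν := by
    have f1 : IsFiniteMeasure (ENNReal.ofReal p₁ • Measure.dirac a) :=
      Measure.smul_finite _ ENNReal.ofReal_ne_top
    have f2 : IsFiniteMeasure (ENNReal.ofReal p₂ • μ) :=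
      Measure.smul_finite _ ENNReal.ofReal_ne_top
    have f3 : IsFiniteMeasure (ENNReal.ofReal (1 - p₁ - p₂) • ν) :=
      Measure.smul_finite _ ENNReal.ofReal_ne_top
    rw [lst_mul_of_indepFun hVn hW hi1 hs, hV n, integral_add_measure (hI _) (hI _),
      integral_add_measure (hI _) (hI _), integral_smul_measure, integral_smul_measure,
      integral_smul_measure, integral_dirac, ENNReal.toReal_ofReal hp₁, ENNReal.toReal_ofReal hp₂,
      ENNReal.toReal_ofReal (by linarith), mul_comm s]
    simp only [Complex.real_smul]
    push_cast
    rfl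
  have e2 := lst_max_add_lst_min (P := P)
    (X := fun ω => V n ω * waiting w V B A n ω + B n ω - A n ω) (by fun_prop) hs
  have e3 := lst_add_of_indepFun (P := P) (X := fun ω => V n ω * waiting w V B A n ω)
    (Y := fun ω => B n ω - A n ω) (by fun_prop) (by fun_prop) hi2 s
  have e4 : lst P (fun ω => B n ω - A n ω) s = ∫ y, Complex.exp (-s * (y : ℂ)) ∂η := by
    rw [← hY n, lst_map (f := fun ω => B n ω - A n ω) (by fun_prop)]
  simp only [waiting]
  rw [e2, ← e1, ← e4, mul_comm, ← e3]
  simp only [add_sub_assoc]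

end Waiting

/-! ### Analytic properties of Z and J⁻, and the boundary problem -/

theorem ae_mem_of_measure_eq_one {μ : Measure ℝ} [IsProbabilityMeasure μ] {S : Set ℝ}
    (hS : MeasurableSet S) (h : μ S = 1) : ∀ᵐ y ∂μ, y ∈ S :=
  (prob_compl_eq_zero_iff hS).2 h

section Transforms

variable {Ω : Type*} [MeasurableSpace Ω] {P : Measure Ω}
  {V B A : ℕ → Ω → ℝ} {w r : ℝ} {s : ℂ}

variable [IsProbabilityMeasure P]

theorem norm_transZ_le (hw : 0 ≤ w) (hr₀ : 0 ≤ r) (hr₁ : r < 1) (hs : 0 ≤ s.re) :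
    ‖transZ P w V B A r s‖ ≤ (1 - r)⁻¹ :=
  norm_genLst_le hr₀ hr₁ fun n => Filter.Eventually.of_forall fun ω =>
    mul_nonneg hs (waiting_nonneg hw n ω)

theorem norm_transJ_le (hr₀ : 0 ≤ r) (hr₁ : r < 1) (hs : s.re ≤ 0) :
    ‖transJ P w V B A r s‖ ≤ (1 - r)⁻¹ :=
  norm_genLst_le hr₀ hr₁ fun _ => Filter.Eventually.of_forall fun _ =>
    mul_nonneg_of_nonpos_of_nonpos hs (min_le_right _ _)

theorem transZ_zero (hr₀ : 0 ≤ r) (hr₁ : r < 1) : transZ P w V B A r 0 = 1 / (1 - (r : ℂ)) := by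
  have : ‖(r : ℂ)‖ < 1 := by rwa [Complex.norm_real, Real.norm_of_nonneg hr₀]
  simp [transZ, lst, tsum_geometric_of_norm_lt_one this]

theorem measurable_min_step (hVm : ∀ n, Measurable (V n)) (hBm : ∀ n, Measurable (B n))
    (hAm : ∀ n, Measurable (A n)) (n : ℕ) :
    Measurable fun ω => min (V n ω * waiting w V B A n ω + B n ω - A n ω) 0 := by
  have := measurable_waiting (w := w) hVm hBm hAm n
  have := hVm n
  have := hBm n
  have := hAm n
  fun_prop

section Measurable

variable (hVm : ∀ n, Measurable (V n)) (hBm : ∀ n, Measurable (B n)) (hAm : ∀ n, Measurable (A n))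
  (hr₀ : 0 ≤ r) (hr₁ : r < 1)
include hVm hBm hAm hr₀ hr₁

theorem continuousOn_transZ (hw : 0 ≤ w) : ContinuousOn (transZ P w V B A r) {s | 0 ≤ s.re} :=
  continuousOn_genLst hr₀ hr₁ (measurable_waiting hVm hBm hAm)
    fun n => Filter.Eventually.of_forall fun ω => waiting_nonneg hw n ω

theorem differentiableOn_transZ (hw : 0 ≤ w) :
    DifferentiableOn ℂ (transZ P w V B A r) {s | 0 < s.re} :=
  differentiableOn_genLst hr₀ hr₁ (measurable_waiting hVm hBm hAm)
    fun n => Filter.Eventually.of_forall fun ω => waiting_nonneg hw n ω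

theorem continuousOn_transJ : ContinuousOn (transJ P w V B A r) {s | s.re ≤ 0} :=
  continuousOn_genLst_of_nonpos hr₀ hr₁ (measurable_min_step hVm hBm hAm)
    fun _ => Filter.Eventually.of_forall fun _ => min_le_right _ _

theorem differentiableOn_transJ : DifferentiableOn ℂ (transJ P w V B A r) {s | s.re < 0} :=
  differentiableOn_genLst_of_nonpos hr₀ hr₁ (measurable_min_step hVm hBm hAm)
    fun _ => Filter.Eventually.of_forall fun _ => min_le_right _ _

variable {μ : Measure ℝ} [IsProbabilityMeasure μ]

theorem integral_transZ_mul (hw : 0 ≤ w) (h : ∀ᵐ y ∂μ, 0 ≤ s.re * y) :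
    ∫ y : ℝ, transZ P w V B A r (s * (y : ℂ)) ∂μ
      = genLst (μ.prod P) (fun n p => p.1 * waiting w V B A n p.2) r s :=
  integral_genLst_mul hr₀ hr₁ (measurable_waiting hVm hBm hAm) (waiting_nonneg hw) h

theorem norm_integral_transZ_mul_le (hw : 0 ≤ w) (h : ∀ᵐ y ∂μ, 0 ≤ s.re * y) :
    ‖∫ y : ℝ, transZ P w V B A r (s * (y : ℂ)) ∂μ‖ ≤ (1 - r)⁻¹ := by
  rw [integral_transZ_mul hVm hBm hAm hr₀ hr₁ hw h]
  exact norm_genLst_le hr₀ hr₁ fun n => ae_prod_re_mul_nonneg (waiting_nonneg hw n) h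

theorem regular_integral_transZ_mul (hw : 0 ≤ w) (h : ∀ᵐ y ∂μ, 0 ≤ y) :
    ContinuousOn (fun s : ℂ => ∫ y : ℝ, transZ P w V B A r (s * (y : ℂ)) ∂μ) {s | 0 ≤ s.re} ∧
    DifferentiableOn ℂ (fun s : ℂ => ∫ y : ℝ, transZ P w V B A r (s * (y : ℂ)) ∂μ)
      {s | 0 < s.re} := by
  have hm : ∀ n, Measurable fun p : ℝ × Ω => p.1 * waiting w V B A n p.2 := fun n => by
    have := measurable_waiting (w := w) hVm hBm hAm n
    fun_prop
  have h0 : ∀ n, ∀ᵐ p ∂(μ.prod P), 0 ≤ p.1 * waiting w V B A n p.2 := fun n => by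
    filter_upwards [Measure.quasiMeasurePreserving_fst.ae h] with p hp
    exact mul_nonneg hp (waiting_nonneg hw n _)
  refine ⟨(continuousOn_genLst hr₀ hr₁ hm h0).congr fun s hs => ?_,
    (differentiableOn_genLst hr₀ hr₁ hm h0).congr fun s hs => ?_⟩
  · exact integral_transZ_mul hVm hBm hAm hr₀ hr₁ hw (h.mono fun y => mul_nonneg hs)
  · exact integral_transZ_mul hVm hBm hAm hr₀ hr₁ hw (h.mono fun y => mul_nonneg (le_of_lt hs))

theorem regular_integral_transZ_mul_of_nonpos (hw : 0 ≤ w) (h : ∀ᵐ y ∂μ, y ≤ 0) :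
    ContinuousOn (fun s : ℂ => ∫ y : ℝ, transZ P w V B A r (s * (y : ℂ)) ∂μ) {s | s.re ≤ 0} ∧
    DifferentiableOn ℂ (fun s : ℂ => ∫ y : ℝ, transZ P w V B A r (s * (y : ℂ)) ∂μ)
      {s | s.re < 0} := by
  have hm : ∀ n, Measurable fun p : ℝ × Ω => p.1 * waiting w V B A n p.2 := fun n => by
    have := measurable_waiting (w := w) hVm hBm hAm n
    fun_prop
  have h0 : ∀ n, ∀ᵐ p ∂(μ.prod P), p.1 * waiting w V B A n p.2 ≤ 0 := fun n => by
    filter_upwards [Measure.quasiMeasurePreserving_fst.ae h] with p hp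
    exact mul_nonpos_of_nonpos_of_nonneg hp (waiting_nonneg hw n _)
  refine ⟨(continuousOn_genLst_of_nonpos hr₀ hr₁ hm h0).congr fun s hs => ?_,
    (differentiableOn_genLst_of_nonpos hr₀ hr₁ hm h0).congr fun s hs => ?_⟩
  · exact integral_transZ_mul hVm hBm hAm hr₀ hr₁ hw
      (h.mono fun y => mul_nonneg_of_nonpos_of_nonpos hs)
  · exact integral_transZ_mul hVm hBm hAm hr₀ hr₁ hw
      (h.mono fun y => mul_nonneg_of_nonpos_of_nonpos (le_of_lt hs))

variable {ν : Measure ℝ} [IsProbabilityMeasure ν]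

/-- The generating-function form of the recursion on the imaginary axis. -/
theorem transZ_sub_add_transJ
    (hind : iIndepFun (Sum.elim V fun n ω => B n ω - A n ω) P)
    {a p₁ p₂ : ℝ} (hp₁ : 0 ≤ p₁) (hp₂ : 0 ≤ p₂) (hp : p₁ + p₂ ≤ 1)
    (hV : ∀ n, P.map (V n) =
      ENNReal.ofReal p₁ • Measure.dirac a + ENNReal.ofReal p₂ • μ
        + ENNReal.ofReal (1 - p₁ - p₂) • ν)
    {η : Measure ℝ} (hY : ∀ n, P.map (fun ω => B n ω - A n ω) = η)
    (hw : 0 ≤ w) (hs : s.re = 0) :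
    transZ P w V B A r s - Complex.exp (-s * (w : ℂ)) + r * transJ P w V B A r s
      = r * (1 / (1 - (r : ℂ)) + (∫ y, Complex.exp (-s * (y : ℂ)) ∂η) *
        (p₁ * transZ P w V B A r (a * s)
          + p₂ * (∫ y : ℝ, transZ P w V B A r (s * (y : ℂ)) ∂μ)
          + (1 - p₁ - p₂) * ∫ y : ℝ, transZ P w V B A r (s * (y : ℂ)) ∂ν)) := by
  have hr : ‖(r : ℂ)‖ < 1 := by rwa [Complex.norm_real, Real.norm_of_nonneg hr₀]
  have hz : ∀ (κ : Measure ℝ), ∀ᵐ y ∂κ, 0 ≤ s.re * y := fun κ => by simp [hs]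
  have hWm := measurable_waiting (w := w) hVm hBm hAm
  have hWn : ∀ n ω, 0 ≤ waiting w V B A n ω := waiting_nonneg hw
  have hmix : ∀ (κ : Measure ℝ) [IsProbabilityMeasure κ],
      HasSum (fun n : ℕ => (r : ℂ) ^ n * ∫ y : ℝ, lst P (waiting w V B A n) (s * (y : ℂ)) ∂κ)
        (∫ y : ℝ, transZ P w V B A r (s * (y : ℂ)) ∂κ) := fun κ _ => by
    rw [integral_transZ_mul hVm hBm hAm hr₀ hr₁ hw (hz κ)]
    simp only [fun n => integral_lst_mul (Q := P) (hWm n) (hWn n) (hz κ)]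
    exact hasSum_genLst hr₀ hr₁ fun n => ae_prod_re_mul_nonneg (hWn n) (hz κ)
  have h1 : HasSum (fun n : ℕ => (r : ℂ) ^ n * lst P (waiting w V B A n) (a * s))
      (transZ P w V B A r (a * s)) :=
    hasSum_genLst hr₀ hr₁ (fun n => by simp [hs])
  have hJ : HasSum (fun n : ℕ => (r : ℂ) ^ n *
      lst P (fun ω => min (V n ω * waiting w V B A n ω + B n ω - A n ω) 0) s)
      (transJ P w V B A r s) :=
    hasSum_genLst hr₀ hr₁ (fun n => by simp [hs])
  have hZ : HasSum (fun n : ℕ => (r : ℂ) ^ n * lst P (waiting w V B A n) s)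
      (transZ P w V B A r s) :=
    hasSum_genLst hr₀ hr₁ (fun n => by simp [hs])
  have hT : HasSum (fun n : ℕ => (r : ℂ) ^ n * lst P (waiting w V B A (n + 1)) s)
      (genLst P (fun n => waiting w V B A (n + 1)) r s) :=
    hasSum_genLst hr₀ hr₁ (fun n => by simp [hs])
  have e1 : transZ P w V B A r s = Complex.exp (-s * (w : ℂ))
      + r * genLst P (fun n => waiting w V B A (n + 1)) r s := by
    refine hZ.unique ?_
    have h2 : HasSum (fun n : ℕ => (r : ℂ) ^ (n + 1) * lst P (waiting w V B A (n + 1)) s)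
        (r * genLst P (fun n => waiting w V B A (n + 1)) r s) :=
      (hT.mul_left (r : ℂ)).congr_fun fun n => by ring
    have h3 := (hasSum_nat_add_iff (f := fun n : ℕ => (r : ℂ) ^ n * lst P (waiting w V B A n) s)
      1).1 h2
    have h4 : lst P (waiting w V B A 0) s = Complex.exp (-s * (w : ℂ)) := by simp [lst, waiting]
    rwa [Finset.sum_range_one, pow_zero, one_mul, h4, add_comm] at h3
  have hR := (hasSum_geometric_of_norm_lt_one hr).add
    ((((h1.mul_left (p₁ : ℂ)).add ((hmix μ).mul_left (p₂ : ℂ))).add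
      ((hmix ν).mul_left (1 - p₁ - p₂ : ℂ))).mul_left (∫ y, Complex.exp (-s * (y : ℂ)) ∂η))
  have e2 := (hT.add hJ).unique (hR.congr_fun fun n => ?_)
  · rw [e1, one_div, ← e2]
    ring
  · have := lst_waiting_succ_add hVm hBm hAm hind hp₁ hp₂ hp hV hY hw hs n
    linear_combination (r : ℂ) ^ n * this

/-- Both sides of the boundary identity are restrictions of one polynomial. -/
theorem exists_polyC_half_planes
    (hind : iIndepFun (Sum.elim V fun n ω => B n ω - A n ω) P)
    {a p₁ p₂ : ℝ} (ha : 0 ≤ a) (hp₁ : 0 ≤ p₁) (hp₂ : 0 ≤ p₂) (hp : p₁ + p₂ ≤ 1)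
    (hμ : ∀ᵐ y ∂μ, 0 ≤ y) (hν : ∀ᵐ y ∂ν, y ≤ 0)
    (hV : ∀ n, P.map (V n) =
      ENNReal.ofReal p₁ • Measure.dirac a + ENNReal.ofReal p₂ • μ
        + ENNReal.ofReal (1 - p₁ - p₂) • ν)
    {η : Measure ℝ} (hY : ∀ n, P.map (fun ω => B n ω - A n ω) = η)
    {L M : ℕ} {N : Polynomial ℂ} {t : Fin L → ℂ} {u : Fin M → ℂ}
    (ht : ∀ j, 0 < (t j).re) (hu : ∀ j, (u j).re < 0)
    (hφ : ∀ s : ℂ, s.re = 0 →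
      ∫ y, Complex.exp (-s * (y : ℂ)) ∂η = N.eval s / denomY t u s)
    (hw : 0 ≤ w) :
    ∃ C : Fin (M + L + 1) → ℂ,
      (∀ s : ℂ, 0 ≤ s.re →
        denomY t u s * (transZ P w V B A r s - Complex.exp (-s * (w : ℂ)))
          - (r : ℂ) * p₁ * N.eval s * transZ P w V B A r (a * s)
          - (r : ℂ) * p₂ * N.eval s * ∫ y : ℝ, transZ P w V B A r (s * (y : ℂ)) ∂μ
          = polyC C s) ∧
      (∀ s : ℂ, s.re ≤ 0 →
        (r : ℂ) * (1 - p₁ - p₂) * N.eval s * (∫ y : ℝ, transZ P w V B A r (s * (y : ℂ)) ∂ν)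
          + (r : ℂ) * denomY t u s * (1 / (1 - (r : ℂ)) - transJ P w V B A r s) = polyC C s) := by
  have hη : IsProbabilityMeasure η := by
    rw [← hY 0]
    exact Measure.isProbabilityMeasure_map ((hBm 0).sub (hAm 0)).aemeasurable
  -- On the axis N/D is a characteristic function, hence |N| ≤ |D| there.
  have hdeg : N.natDegree ≤ M + L := by
    rw [← natDegree_denomPoly t u]
    refine Polynomial.natDegree_le_of_norm_eval_le fun s hs => ?_
    have h1 : ‖lst η id s‖ ≤ 1 := norm_lst_le_one (by simp [hs])
    have h2 : lst η id s = N.eval s / denomY t u s := hφ s hs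
    have h3 := denomY_ne_zero ht hu hs
    rwa [h2, norm_div, div_le_one (norm_pos_iff.2 h3), ← eval_denomPoly] at h1
  obtain ⟨cN, hcN, hN⟩ := N.exists_norm_eval_le hdeg
  obtain ⟨cD, hcD, hD⟩ := (denomPoly t u).exists_norm_eval_le (natDegree_denomPoly t u).le
  simp only [eval_denomPoly] at hD
  set Z := transZ P w V B A r with hZdef
  have hZc : ContinuousOn Z {s | 0 ≤ s.re} := continuousOn_transZ hVm hBm hAm hr₀ hr₁ hw
  have hZd : DifferentiableOn ℂ Z {s | 0 < s.re} := differentiableOn_transZ hVm hBm hAm hr₀ hr₁ hw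
  have hDd := differentiable_denomY t u
  have hNd : Differentiable ℂ fun s => N.eval s := N.differentiable
  have hμr := regular_integral_transZ_mul (P := P) hVm hBm hAm hr₀ hr₁ hw hμ
  have hνr := regular_integral_transZ_mul_of_nonpos (P := P) hVm hBm hAm hr₀ hr₁ hw hν
  have hZac : ContinuousOn (fun s => Z (a * s)) {s | 0 ≤ s.re} :=
    hZc.comp (by fun_prop) fun s hs => by
      simpa using mul_nonneg ha hs
  have hZad : DifferentiableOn ℂ (fun s => Z (a * s)) {s | 0 < s.re} := by
    -- For a = 0 the argument leaves the open half plane, but the function is then constant.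
    rcases ha.eq_or_lt with rfl | ha
    · simp
    · exact hZd.comp (by fun_prop) fun s hs => by
        simpa using mul_pos ha hs
  let f : ℂ → ℂ := fun s => denomY t u s * (Z s - Complex.exp (-s * (w : ℂ)))
    - (r : ℂ) * p₁ * N.eval s * Z (a * s)
    - (r : ℂ) * p₂ * N.eval s * ∫ y : ℝ, Z (s * (y : ℂ)) ∂μ
  let g : ℂ → ℂ := fun s =>
    (r : ℂ) * (1 - p₁ - p₂) * N.eval s * (∫ y : ℝ, Z (s * (y : ℂ)) ∂ν)
      + (r : ℂ) * denomY t u s * (1 / (1 - (r : ℂ)) - transJ P w V B A r s)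
  obtain ⟨F, hFd, hF1, hF2⟩ : ∃ F : ℂ → ℂ, Differentiable ℂ F ∧
      (∀ s : ℂ, 0 ≤ s.re → F s = f s) ∧ ∀ s : ℂ, s.re ≤ 0 → F s = g s := by
    refine exists_entire_of_eq_on_imaginary_axis ?_ ?_ ?_ ?_ ?_
    · exact ((hDd.continuous.continuousOn.mul (hZc.sub (by fun_prop))).sub
        ((continuousOn_const.mul hNd.continuous.continuousOn).mul hZac)).sub
        ((continuousOn_const.mul hNd.continuous.continuousOn).mul hμr.1)
    · exact ((hDd.differentiableOn.mul (hZd.sub (by fun_prop))).sub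
        (((differentiableOn_const _).mul hNd.differentiableOn).mul hZad)).sub
        (((differentiableOn_const _).mul hNd.differentiableOn).mul hμr.2)
    · exact ((continuousOn_const.mul hNd.continuous.continuousOn).mul hνr.1).add
        ((continuousOn_const.mul hDd.continuous.continuousOn).mul
          (continuousOn_const.sub (continuousOn_transJ hVm hBm hAm hr₀ hr₁)))
    · exact (((differentiableOn_const _).mul hNd.differentiableOn).mul hνr.2).add
        (((differentiableOn_const _).mul hDd.differentiableOn).mul
          ((differentiableOn_const _).sub (differentiableOn_transJ hVm hBm hAm hr₀ hr₁)))
    · intro s hs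
      have h1 := transZ_sub_add_transJ (P := P) hVm hBm hAm hr₀ hr₁ hind hp₁ hp₂ hp hV hY hw hs
      rw [hφ s hs] at h1
      have h3 := denomY_ne_zero ht hu hs
      have h4 : denomY t u s * (N.eval s / denomY t u s) = N.eval s := mul_div_cancel₀ _ h3
      simp only [f, g]
      rw [← hZdef] at h1
      linear_combination denomY t u s * h1 + r *
          (p₁ * Z (a * s) + p₂ * (∫ y : ℝ, Z (s * (y : ℂ)) ∂μ)
            + (1 - p₁ - p₂) * ∫ y : ℝ, Z (s * (y : ℂ)) ∂ν) * h4
  have hr : 0 ≤ (1 - r)⁻¹ := inv_nonneg.2 (by linarith)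
  have hrc : ‖(r : ℂ)‖ ≤ 1 := by rw [Complex.norm_real, Real.norm_of_nonneg hr₀]; exact hr₁.le
  have hp1c : ‖(p₁ : ℂ)‖ ≤ 1 := by
    rw [Complex.norm_real, Real.norm_of_nonneg hp₁]; linarith
  have hp2c : ‖(p₂ : ℂ)‖ ≤ 1 := by
    rw [Complex.norm_real, Real.norm_of_nonneg hp₂]; linarith
  have hp3c : ‖(1 - p₁ - p₂ : ℂ)‖ ≤ 1 := by
    rw [← Complex.ofReal_one, ← Complex.ofReal_sub, ← Complex.ofReal_sub, Complex.norm_real,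
      Real.norm_of_nonneg (by linarith)]
    linarith
  have hrr : ‖1 / (1 - (r : ℂ))‖ = (1 - r)⁻¹ := by
    rw [← Complex.ofReal_one, ← Complex.ofReal_sub, ← Complex.ofReal_div, Complex.norm_real,
      one_div, Real.norm_of_nonneg hr]
  have hprod : ∀ (x y z v : ℂ) (Y : ℝ), ‖x‖ ≤ 1 → ‖y‖ ≤ 1 → ‖v‖ ≤ Y →
      ‖x * y * z * v‖ ≤ ‖z‖ * Y := by
    intro x y z v Y hx hy hv
    rw [norm_mul, norm_mul, norm_mul]
    refine mul_le_mul ?_ hv (norm_nonneg _) (norm_nonneg _)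
    exact mul_le_of_le_one_left (norm_nonneg _) (mul_le_one₀ hx (norm_nonneg _) hy)
  -- With R = 1/(1-r), the right half plane costs |D|(R+1) + 2|N|R and the left one 2|D|R + |N|R.
  -- The constant c dominates both.
  obtain ⟨C, hC⟩ := exists_polyC_of_growth hFd (d := M + L)
    (c := cD * (2 * (1 - r)⁻¹ + 1) + 2 * (cN * (1 - r)⁻¹)) (fun s => by
      have hpow : 0 ≤ (1 + ‖s‖) ^ (M + L) := by positivity
      rcases le_total 0 s.re with hs | hs
      · rw [hF1 s hs]
        have b1 : ‖Z s - Complex.exp (-s * (w : ℂ))‖ ≤ (1 - r)⁻¹ + 1 :=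
          (norm_sub_le _ _).trans (add_le_add (norm_transZ_le hw hr₀ hr₁ hs)
            (norm_exp_neg_mul_ofReal_le_one (mul_nonneg hs hw)))
        have b2 : ‖Z (a * s)‖ ≤ (1 - r)⁻¹ := norm_transZ_le hw hr₀ hr₁
          (by simpa using mul_nonneg ha hs)
        have b3 : ‖∫ y : ℝ, Z (s * (y : ℂ)) ∂μ‖ ≤ (1 - r)⁻¹ :=
          norm_integral_transZ_mul_le hVm hBm hAm hr₀ hr₁ hw (hμ.mono fun y => mul_nonneg hs)
        calc ‖f s‖ ≤ ‖denomY t u s‖ * ((1 - r)⁻¹ + 1) + ‖N.eval s‖ * (1 - r)⁻¹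
              + ‖N.eval s‖ * (1 - r)⁻¹ := by
              refine (norm_sub_le _ _).trans (add_le_add ((norm_sub_le _ _).trans
                (add_le_add ?_ (hprod _ _ _ _ _ hrc hp1c b2))) (hprod _ _ _ _ _ hrc hp2c b3))
              rw [norm_mul]
              exact mul_le_mul_of_nonneg_left b1 (norm_nonneg _)
          _ ≤ cD * (1 + ‖s‖) ^ (M + L) * (2 * (1 - r)⁻¹ + 1)
              + cN * (1 + ‖s‖) ^ (M + L) * (1 - r)⁻¹
              + cN * (1 + ‖s‖) ^ (M + L) * (1 - r)⁻¹ := by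
              have := hD s
              have := hN s
              gcongr
              linarith
          _ = _ := by ring
      · rw [hF2 s hs]
        have b1 : ‖1 / (1 - (r : ℂ)) - transJ P w V B A r s‖ ≤ 2 * (1 - r)⁻¹ := by
          refine (norm_sub_le _ _).trans ?_
          rw [hrr]
          linarith [norm_transJ_le (P := P) (V := V) (B := B) (A := A) (w := w) hr₀ hr₁ hs]
        have b3 : ‖∫ y : ℝ, Z (s * (y : ℂ)) ∂ν‖ ≤ (1 - r)⁻¹ :=
          norm_integral_transZ_mul_le hVm hBm hAm hr₀ hr₁ hw
            (hν.mono fun y => mul_nonneg_of_nonpos_of_nonpos hs)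
        calc ‖g s‖ ≤ ‖N.eval s‖ * (1 - r)⁻¹ + ‖denomY t u s‖ * (2 * (1 - r)⁻¹) := by
              refine (norm_add_le _ _).trans (add_le_add (hprod _ _ _ _ _ hrc hp3c b3) ?_)
              rw [norm_mul, norm_mul]
              exact mul_le_mul (mul_le_of_le_one_left (norm_nonneg _) hrc) b1 (norm_nonneg _)
                (norm_nonneg _)
          _ ≤ cN * (1 + ‖s‖) ^ (M + L) * (1 - r)⁻¹
              + cD * (1 + ‖s‖) ^ (M + L) * (2 * (1 - r)⁻¹) := by
              have := hD s
              have := hN s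
              gcongr
          _ ≤ cN * (1 + ‖s‖) ^ (M + L) * (1 - r)⁻¹
              + cD * (1 + ‖s‖) ^ (M + L) * (2 * (1 - r)⁻¹)
              + (cN * (1 + ‖s‖) ^ (M + L) * (1 - r)⁻¹ + cD * (1 + ‖s‖) ^ (M + L)) :=
              le_add_of_nonneg_right (by positivity)
          _ = _ := by ring)
  exact ⟨C, fun s hs => by rw [← hC, hF1 s hs], fun s hs => by rw [← hC, hF2 s hs]⟩

end Measurable

end Transforms

/-! ### The exponential Lyapunov function -/

section Exponential

variable {μ : Measure ℝ} [IsProbabilityMeasure μ]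

/-- Dominated convergence. The strict inequality v < 1 almost surely is essential: an atom at 1
would survive in the limit. -/
theorem tendsto_integral_exp_neg_mul (hμ : ∀ᵐ v ∂μ, v ∈ Set.Ico (0 : ℝ) 1) {δ : ℝ} (hδ : 0 < δ) :
    Filter.Tendsto (fun β : ℕ => ∫ v, Real.exp (-(β * (δ * (1 - v)))) ∂μ) Filter.atTop
      (nhds 0) := by
  have h := tendsto_integral_of_dominated_convergence (μ := μ)
    (F := fun (β : ℕ) v => Real.exp (-(β * (δ * (1 - v))))) (f := fun _ => 0) (fun _ => 1)
    (fun β => by fun_prop) (integrable_const _) (fun β => ?_) ?_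
  · simpa using h
  · filter_upwards [hμ] with v hv
    rw [Real.norm_eq_abs, Real.abs_exp, Real.exp_le_one_iff, neg_nonpos]
    have : 0 ≤ 1 - v := by linarith [hv.2]
    positivity
  · filter_upwards [hμ] with v hv
    refine Real.tendsto_exp_neg_atTop_nhds_zero.comp ?_
    exact tendsto_natCast_atTop_atTop.atTop_mul_const (mul_pos hδ (by linarith [hv.2]))

theorem integrable_exp_mul_of_mem_Ico (hμ : ∀ᵐ v ∂μ, v ∈ Set.Ico (0 : ℝ) 1) (c : ℝ) :
    Integrable (fun v => Real.exp (c * v)) μ := by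
  refine Integrable.of_bound (by fun_prop) (Real.exp |c|) ?_
  filter_upwards [hμ] with v hv
  rw [Real.norm_eq_abs, Real.abs_exp, Real.exp_le_exp]
  calc c * v ≤ |c * v| := le_abs_self _
    _ = |c| * v := by rw [abs_mul, abs_of_nonneg hv.1]
    _ ≤ |c| := mul_le_of_le_one_right (abs_nonneg _) hv.2.le

/-- A Lyapunov estimate: for large `β` the function `x ↦ exp (β x)` is contracted by the kernel
`κ(x) μ(dv)`, `x ↦ x v`, as soon as `κ` is small near `0`. -/
theorem eventually_mul_integral_exp_le (hμ : ∀ᵐ v ∂μ, v ∈ Set.Ico (0 : ℝ) 1) {κ : ℝ → ℝ}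
    (hκ : ContinuousOn κ (Set.Icc 0 1)) (hκ0 : ∀ x, 0 ≤ κ x) {ρ : ℝ} (hρ : κ 0 < ρ) :
    ∀ᶠ β : ℕ in Filter.atTop, ∀ x ∈ Set.Icc (0 : ℝ) 1,
      κ x * ∫ v, Real.exp (β * x * v) ∂μ ≤ ρ * Real.exp (β * x) := by
  have hρ0 : 0 < ρ := (hκ0 0).trans_lt hρ
  obtain ⟨B, hB⟩ := isCompact_Icc.exists_bound_of_continuousOn hκ
  have hB' : ∀ x ∈ Set.Icc (0 : ℝ) 1, κ x ≤ |B| + 1 := fun x hx =>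
    ((le_abs_self _).trans (hB x hx)).trans ((le_abs_self B).trans (by linarith))
  obtain ⟨δ, hδ, hδκ⟩ : ∃ δ > 0, ∀ x ∈ Set.Icc (0 : ℝ) 1, x < δ → κ x ≤ ρ := by
    have := (hκ 0 (by simp)).eventually (gt_mem_nhds hρ)
    rw [eventually_nhdsWithin_iff, Metric.eventually_nhds_iff] at this
    obtain ⟨δ, hδ, h⟩ := this
    refine ⟨δ, hδ, fun x hx hxδ => (h ?_ hx).le⟩
    rwa [Real.dist_eq, sub_zero, abs_of_nonneg hx.1]
  have hBpos : 0 < |B| + 1 := by positivity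
  have hev := (tendsto_integral_exp_neg_mul hμ hδ).eventually (gt_mem_nhds (div_pos hρ0 hBpos))
  filter_upwards [hev] with β hβ x hx
  -- Near 0 the factor κ is at most ρ and exp(βxv) ≤ exp(βx). For x ≥ δ only boundedness of κ is
  -- used: exp(βxv) ≤ exp(βx) exp(-βδ(1-v)), and the integral of the last factor is below ρ/(|B|+1),
  -- uniformly in x.
  rcases lt_or_ge x δ with hxδ | hxδ
  · refine mul_le_mul (hδκ x hx hxδ) ?_ (integral_nonneg fun v => (Real.exp_pos _).le) hρ0.le
    have : ∫ v, Real.exp (β * x * v) ∂μ ≤ ∫ _, Real.exp (β * x) ∂μ := by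
      refine integral_mono_ae (integrable_exp_mul_of_mem_Ico hμ _) (integrable_const _) ?_
      filter_upwards [hμ] with v hv
      rw [Real.exp_le_exp]
      exact mul_le_of_le_one_right (mul_nonneg (Nat.cast_nonneg _) hx.1) hv.2.le
    simpa using this
  · have h1 : ∫ v, Real.exp (β * x * v) ∂μ ≤
        ∫ v, Real.exp (β * x) * Real.exp (-(β * (δ * (1 - v)))) ∂μ := by
      refine integral_mono_ae (integrable_exp_mul_of_mem_Ico hμ _)
        (Integrable.const_mul ?_ _) ?_
      · refine ((integrable_exp_mul_of_mem_Ico hμ (β * δ)).const_mul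
          (Real.exp (-(β * δ)))).congr (Filter.Eventually.of_forall fun v => ?_)
        simp only [← Real.exp_add]
        congr 1; ring
      · filter_upwards [hμ] with v hv
        rw [← Real.exp_add, Real.exp_le_exp]
        have : 0 ≤ β * ((x - δ) * (1 - v)) :=
          mul_nonneg (Nat.cast_nonneg _) (mul_nonneg (by linarith) (by linarith [hv.2]))
        nlinarith
    rw [integral_const_mul] at h1
    calc κ x * ∫ v, Real.exp (β * x * v) ∂μ
        ≤ (|B| + 1) * (Real.exp (β * x) * (ρ / (|B| + 1))) := by
          refine mul_le_mul (hB' x hx) (h1.trans ?_)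
            (integral_nonneg fun v => (Real.exp_pos _).le) hBpos.le
          exact mul_le_mul_of_nonneg_left hβ.le (Real.exp_pos _).le
      _ = ρ * Real.exp (β * x) := by field_simp

end Exponential

/-! ### Scaled arguments and padded sequences -/

section Scaled

theorem scaled_eq (a : ℝ) (y : ℕ → ℝ) (i j : ℕ) (s : ℂ) :
    scaled a y i j s = ((a ^ i * ∏ q ∈ Finset.range j, y q : ℝ) : ℂ) * s := by
  simp [scaled]

theorem scaled_succ_left (a : ℝ) (y : ℕ → ℝ) (i j : ℕ) (s : ℂ) :
    scaled a y (i + 1) j s = a * scaled a y i j s := by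
  simp only [scaled]; ring

theorem scaled_succ_right (a : ℝ) (y : ℕ → ℝ) (i j : ℕ) (s : ℂ) :
    scaled a y i (j + 1) s = scaled a y i j s * y j := by
  simp only [scaled, Finset.prod_range_succ]; ring

theorem scaled_congr {a : ℝ} {y y' : ℕ → ℝ} {i j : ℕ} {s : ℂ} (h : ∀ q < j, y q = y' q) :
    scaled a y i j s = scaled a y' i j s := by
  simp only [scaled]
  rw [Finset.prod_congr rfl fun q hq => by rw [h q (Finset.mem_range.1 hq)]]

theorem monomial_mem_Icc {a : ℝ} (ha : a ∈ Set.Icc (0 : ℝ) 1) {y : ℕ → ℝ}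
    (hy : ∀ q, y q ∈ Set.Icc (0 : ℝ) 1) (i j : ℕ) :
    a ^ i * ∏ q ∈ Finset.range j, y q ∈ Set.Icc (0 : ℝ) 1 :=
  ⟨mul_nonneg (pow_nonneg ha.1 _) (Finset.prod_nonneg fun q _ => (hy q).1),
    mul_le_one₀ (pow_le_one₀ ha.1 ha.2) (Finset.prod_nonneg fun q _ => (hy q).1)
      (Finset.prod_le_one (fun q _ => (hy q).1) fun q _ => (hy q).2)⟩

theorem weightG_congr {K : ℂ → ℂ} {a : ℝ} {y y' : ℕ → ℝ} {s : ℂ} : ∀ {i j : ℕ},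
    (∀ q < j, y q = y' q) → weightG K a y s i j = weightG K a y' s i j
  | 0, 0, _ => by simp only [weightG]
  | i + 1, 0, h => by rw [weightG, weightG, weightG_congr h, scaled_congr h]
  | 0, j + 1, h => by
    have h' : ∀ q < j, y q = y' q := fun q hq => h q (by omega)
    rw [weightG, weightG, weightG_congr h', scaled_congr h']
  | i + 1, j + 1, h => by
    have h' : ∀ q < j, y q = y' q := fun q hq => h q (by omega)
    rw [weightG, weightG, weightG_congr h, weightG_congr h', scaled_congr h, scaled_congr h']

theorem pathWeight_congr {K : ℂ → ℂ} {a : ℝ} {y y' : ℕ → ℝ} {s : ℂ} {n i j : ℕ}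
    {c : Fin (n + 1) → ℕ × ℕ} (hc : IsLatticePath n i j c) (h : ∀ q < j, y q = y' q) :
    pathWeight K a y s c = pathWeight K a y' s c := by
  refine Finset.prod_congr rfl fun l _ => ?_
  have : (c l.castSucc).2 ≤ j := by
    have := (hc.monotone (Fin.le_last l.castSucc)).2
    rwa [hc.2.1] at this
  rw [scaled_congr fun q hq => h q (by omega)]

theorem padSeq_init {j : ℕ} (y : Fin (j + 1) → ℝ) {q : ℕ} (hq : q < j) :
    padSeq (Fin.init y : Fin j → ℝ) q = padSeq y q := by
  simp [padSeq, hq, Nat.lt_succ_of_lt hq, Fin.init]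

theorem padSeq_last {j : ℕ} (y : Fin (j + 1) → ℝ) : padSeq y j = y (Fin.last j) := by
  simp [padSeq]
  rfl

theorem measurable_padSeq {j : ℕ} (q : ℕ) : Measurable fun y : Fin j → ℝ => padSeq y q := by
  by_cases h : q < j
  · simpa only [padSeq, h, dite_true] using measurable_pi_apply _
  · simpa only [padSeq, h, dite_false] using measurable_const

theorem measurable_monomial_padSeq {j : ℕ} (a : ℝ) (i k : ℕ) :
    Measurable fun y : Fin j → ℝ => a ^ i * ∏ q ∈ Finset.range k, padSeq y q :=
  (Finset.measurable_prod _ fun q _ => measurable_padSeq q).const_mul _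

theorem measurable_scaled_padSeq {j : ℕ} (a : ℝ) (i k : ℕ) (s : ℂ) :
    Measurable fun y : Fin j → ℝ => scaled a (padSeq y) i k s := by
  simp only [scaled_eq]
  exact (Complex.measurable_ofReal.comp (measurable_monomial_padSeq a i k)).mul_const _

theorem measurable_pathWeight {K : ℂ → ℂ} (hK : Measurable K) {j : ℕ} (a : ℝ) (s : ℂ) {n : ℕ}
    (c : Fin (n + 1) → ℕ × ℕ) : Measurable fun y : Fin j → ℝ => pathWeight K a (padSeq y) s c :=
  Finset.measurable_prod _ fun _ _ => hK.comp (measurable_scaled_padSeq _ _ _ _)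

end Scaled

/-! ### The product law and its last coordinate -/

section ProdLaw

variable {μ : Measure ℝ} [IsProbabilityMeasure μ]

instance (j : ℕ) : IsProbabilityMeasure (prodLaw μ j) := by
  unfold prodLaw; infer_instance

/-- The interval is closed because the padding value is 1. -/
theorem ae_padSeq_mem (hμ : ∀ᵐ v ∂μ, v ∈ Set.Ico (0 : ℝ) 1) (j : ℕ) :
    ∀ᵐ y ∂(prodLaw μ j), ∀ q, padSeq y q ∈ Set.Icc (0 : ℝ) 1 := by
  have : ∀ᵐ y ∂(prodLaw μ j), ∀ i, y i ∈ Set.Ico (0 : ℝ) 1 :=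
    Filter.eventually_all.2 fun i =>
      (measurePreserving_eval (fun _ : Fin j => μ) i).quasiMeasurePreserving.ae hμ
  filter_upwards [this] with y hy q
  by_cases h : q < j
  · simpa only [padSeq, h, dite_true] using Set.Ico_subset_Icc_self (hy _)
  · simp [padSeq, h]

theorem measurePreserving_init_last (j : ℕ) :
    MeasurePreserving (fun y : Fin (j + 1) → ℝ => (y (Fin.last j), (Fin.init y : Fin j → ℝ)))
      (prodLaw μ (j + 1)) (μ.prod (prodLaw μ j)) := by
  have := measurePreserving_piFinSuccAbove (fun _ : Fin (j + 1) => μ) (Fin.last j)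
  have e : (fun y : Fin (j + 1) → ℝ => (y (Fin.last j), (Fin.init y : Fin j → ℝ)))
      = MeasurableEquiv.piFinSuccAbove (fun _ => ℝ) (Fin.last j) := by
    funext y
    simp [MeasurableEquiv.piFinSuccAbove, Fin.insertNthEquiv]
  rw [e]
  exact this

/-- Fubini with the last coordinate integrated first, since a vertical step introduces exactly that
coordinate. -/
theorem integral_prodLaw_succ {E : Type*} [NormedAddCommGroup E] [NormedSpace ℝ E]
    {j : ℕ} {f : ℝ → (Fin j → ℝ) → E} (hfm : StronglyMeasurable (Function.uncurry f))
    (hf : Integrable (fun y : Fin (j + 1) → ℝ => f (y (Fin.last j)) (Fin.init y))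
      (prodLaw μ (j + 1))) :
    ∫ y : Fin (j + 1) → ℝ, f (y (Fin.last j)) (Fin.init y) ∂(prodLaw μ (j + 1)) =
      ∫ y, ∫ v, f v y ∂μ ∂(prodLaw μ j) := by
  have hmp := measurePreserving_init_last (μ := μ) j
  have hi : Integrable (Function.uncurry f) (μ.prod (prodLaw μ j)) :=
    (hmp.integrable_comp hfm.aestronglyMeasurable).1 hf
  refine Eq.trans ?_ (integral_prod_symm (Function.uncurry f) hi)
  rw [← hmp.map_eq, integral_map hmp.measurable.aemeasurable hfm.aestronglyMeasurable]
  rfl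

end ProdLaw

theorem sum_antidiagonal_step {I A B : ℕ → ℕ → ℂ} (p q : ℂ) (h₁ : ∀ i, I (i + 1) 0 = A i 0)
    (h₂ : ∀ j, I 0 (j + 1) = B 0 j) (h₃ : ∀ i j, I (i + 1) (j + 1) = A i (j + 1) + B (i + 1) j)
    (k : ℕ) :
    ∑ x ∈ Finset.HasAntidiagonal.antidiagonal (k + 1), p ^ x.1 * q ^ x.2 * I x.1 x.2 =
      p * (∑ x ∈ Finset.HasAntidiagonal.antidiagonal k, p ^ x.1 * q ^ x.2 * A x.1 x.2)
        + q * ∑ x ∈ Finset.HasAntidiagonal.antidiagonal k, p ^ x.1 * q ^ x.2 * B x.1 x.2 := by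
  -- Shifted arrays with value 0 where the left or the lower neighbour is missing. They merge the
  -- boundary cases into a single formula before reindexing.
  let A' : ℕ → ℕ → ℂ := fun i j => Nat.casesOn i 0 fun i => A i j
  let B' : ℕ → ℕ → ℂ := fun i j => Nat.casesOn j 0 fun j => B i j
  have hI : ∀ x ∈ Finset.HasAntidiagonal.antidiagonal (k + 1), p ^ x.1 * q ^ x.2 * I x.1 x.2
      = p ^ x.1 * q ^ x.2 * A' x.1 x.2 + p ^ x.1 * q ^ x.2 * B' x.1 x.2 := by
    rintro ⟨_ | i, _ | j⟩ hx
    · simp at hx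
    · simp [A', B', h₂]
    · simp [A', B', h₁]
    · simp [A', B', h₃, mul_add]
  rw [Finset.sum_congr rfl hI, Finset.sum_add_distrib, Finset.Nat.sum_antidiagonal_succ,
    Finset.Nat.sum_antidiagonal_succ', Finset.mul_sum, Finset.mul_sum]
  have eA : p ^ 0 * q ^ (k + 1) * A' 0 (k + 1) = 0 := by simp [A']
  have eB : p ^ (k + 1) * q ^ 0 * B' (k + 1) 0 = 0 := by simp [B']
  simp only [eA, eB, zero_add]
  congr 1
  · exact Finset.sum_congr rfl fun x _ => by simp only [A']; ring
  · exact Finset.sum_congr rfl fun x _ => by simp only [B']; ring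

/-! ### Geometric decay of mean path weights -/

section PathBounds

variable {μ : Measure ℝ} {a : ℝ} {K : ℂ → ℂ} {s : ℂ} {b : ℝ}

/-- A crude bound that may grow with n. It serves for integrability only; the decay comes from
averaging. -/
theorem norm_pathWeight_le (ha : a ∈ Set.Icc (0 : ℝ) 1)
    (hb : ∀ x ∈ Set.Icc (0 : ℝ) 1, ‖K (x * s)‖ ≤ b) {y : ℕ → ℝ}
    (hy : ∀ q, y q ∈ Set.Icc (0 : ℝ) 1) {n : ℕ} (c : Fin (n + 1) → ℕ × ℕ) :
    ‖pathWeight K a y s c‖ ≤ b ^ n := by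
  rw [pathWeight, norm_prod]
  calc _ ≤ ∏ _l : Fin n, b := Finset.prod_le_prod (fun _ _ => norm_nonneg _) fun l _ => by
        rw [scaled_eq]; exact hb _ (monomial_mem_Icc ha hy _ _)
    _ = b ^ n := by simp

variable [IsProbabilityMeasure μ]

theorem integrable_pathWeight_mul (hμ : ∀ᵐ v ∂μ, v ∈ Set.Ico (0 : ℝ) 1)
    (ha : a ∈ Set.Icc (0 : ℝ) 1) (hK : Measurable K)
    (hb : ∀ x ∈ Set.Icc (0 : ℝ) 1, ‖K (x * s)‖ ≤ b) {j n : ℕ} (c : Fin (n + 1) → ℕ × ℕ)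
    {h : (Fin j → ℝ) → ℂ} (hm : Measurable h) {B : ℝ} (hB : ∀ᵐ y ∂(prodLaw μ j), ‖h y‖ ≤ B) :
    Integrable (fun y => pathWeight K a (padSeq y) s c * h y) (prodLaw μ j) := by
  refine Integrable.of_bound ((measurable_pathWeight hK a s c).mul hm).aestronglyMeasurable
    (b ^ n * B) ?_
  filter_upwards [ae_padSeq_mem hμ j, hB] with y hy hBy
  rw [norm_mul]
  have := norm_pathWeight_le ha hb hy c
  exact mul_le_mul this hBy (norm_nonneg _) ((norm_nonneg _).trans this)

theorem integrable_pathWeight (hμ : ∀ᵐ v ∂μ, v ∈ Set.Ico (0 : ℝ) 1)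
    (ha : a ∈ Set.Icc (0 : ℝ) 1) (hK : Measurable K)
    (hb : ∀ x ∈ Set.Icc (0 : ℝ) 1, ‖K (x * s)‖ ≤ b) {j n : ℕ} (c : Fin (n + 1) → ℕ × ℕ) :
    Integrable (fun y => pathWeight K a (padSeq y) s c) (prodLaw μ j) := by
  simpa using integrable_pathWeight_mul hμ ha hK hb c (h := fun _ => 1) measurable_const (B := 1)
    (by simp)

theorem integrable_norm_pathWeight_mul_exp (hμ : ∀ᵐ v ∂μ, v ∈ Set.Ico (0 : ℝ) 1)
    (ha : a ∈ Set.Icc (0 : ℝ) 1) (hK : Measurable K)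
    (hb : ∀ x ∈ Set.Icc (0 : ℝ) 1, ‖K (x * s)‖ ≤ b) {β : ℝ} (hβ : 0 ≤ β) {n : ℕ} (i j k : ℕ)
    (c : Fin (n + 1) → ℕ × ℕ) :
    Integrable (fun y => ‖pathWeight K a (padSeq y) s c‖
      * Real.exp (β * (a ^ i * ∏ q ∈ Finset.range k, padSeq y q))) (prodLaw μ j) := by
  have hm := (measurable_monomial_padSeq (j := j) a i k).const_mul β
  refine (integrable_pathWeight_mul hμ ha hK hb (j := j) c (B := Real.exp β)
    (h := fun y => ((Real.exp (β * (a ^ i * ∏ q ∈ Finset.range k, padSeq y q)) : ℝ) : ℂ))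
    (Complex.measurable_ofReal.comp (Real.measurable_exp.comp hm)) ?_).norm.congr
    (Filter.Eventually.of_forall fun y => ?_)
  · filter_upwards [ae_padSeq_mem hμ j] with y hy
    rw [Complex.norm_real, Real.norm_eq_abs, Real.abs_exp, Real.exp_le_exp]
    exact mul_le_of_le_one_right hβ (monomial_mem_Icc ha hy i k).2
  · simp only [norm_mul, Complex.norm_real, Real.norm_eq_abs, Real.abs_exp]

/-- Along a lattice path the exponentially weighted mean of the path weight decays
geometrically. -/
theorem integral_norm_pathWeight_mul_exp_le (hμ : ∀ᵐ v ∂μ, v ∈ Set.Ico (0 : ℝ) 1)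
    (ha : a ∈ Set.Icc (0 : ℝ) 1) (hK : Measurable K)
    (hb : ∀ x ∈ Set.Icc (0 : ℝ) 1, ‖K (x * s)‖ ≤ b) {β ρ : ℝ} (hβ : 0 ≤ β) (hρ : 0 ≤ ρ)
    (h₁ : ∀ x ∈ Set.Icc (0 : ℝ) 1, ‖K (x * s)‖ * Real.exp (β * x * a) ≤ ρ * Real.exp (β * x))
    (h₂ : ∀ x ∈ Set.Icc (0 : ℝ) 1,
      ‖K (x * s)‖ * ∫ v, Real.exp (β * x * v) ∂μ ≤ ρ * Real.exp (β * x))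
    (n : ℕ) : ∀ {i j : ℕ} {c : Fin (n + 1) → ℕ × ℕ}, IsLatticePath n i j c →
      ∫ y, ‖pathWeight K a (padSeq y) s c‖
        * Real.exp (β * (a ^ i * ∏ q ∈ Finset.range j, padSeq y q)) ∂(prodLaw μ j)
        ≤ ρ ^ n * Real.exp β := by
  induction n with
  | zero =>
    intro i j c hc
    obtain ⟨rfl, rfl⟩ : i = 0 ∧ j = 0 := by simpa using (isLatticePath_zero.1 hc).2
    simp [pathWeight]
  | succ n ih =>
    intro i j c hc
    rcases (isLatticePath_succ.1 hc).2 with ⟨i', rfl, hc'⟩ | ⟨j', rfl, hc'⟩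
    · refine le_trans ?_ (le_of_le_of_eq (mul_le_mul_of_nonneg_left (ih hc') hρ) (by ring :
        _ = ρ ^ (n + 1) * Real.exp β))
      rw [← integral_const_mul]
      refine integral_mono_ae (integrable_norm_pathWeight_mul_exp hμ ha hK hb hβ _ _ _ _)
        ((integrable_norm_pathWeight_mul_exp hμ ha hK hb hβ _ _ _ _).const_mul _) ?_
      filter_upwards [ae_padSeq_mem hμ j] with y hy
      have h := h₁ _ (monomial_mem_Icc ha hy i' j)
      rw [← scaled_eq] at h
      rw [pathWeight_succ K a _ s hc', norm_mul, mul_assoc, mul_left_comm ρ]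
      refine mul_le_mul_of_nonneg_left (le_of_eq_of_le ?_ h) (norm_nonneg _)
      congr 2
      ring
    · refine le_trans ?_ (le_of_le_of_eq (mul_le_mul_of_nonneg_left (ih hc') hρ) (by ring :
        _ = ρ ^ (n + 1) * Real.exp β))
      -- After a vertical step the new variable v enters only through the exponential. Integrating
      -- it out first turns the new factor into the left side of `h₂`.
      let f : ℝ → (Fin j' → ℝ) → ℝ := fun v y =>
        ‖pathWeight K a (padSeq y) s (Fin.init c : Fin (n + 1) → ℕ × ℕ)‖
          * (‖K (scaled a (padSeq y) i j' s)‖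
            * Real.exp (β * (a ^ i * ∏ q ∈ Finset.range j', padSeq y q) * v))
      have hfe : ∀ y : Fin (j' + 1) → ℝ, ‖pathWeight K a (padSeq y) s c‖
          * Real.exp (β * (a ^ i * ∏ q ∈ Finset.range (j' + 1), padSeq y q))
          = f (y (Fin.last j')) (Fin.init y) := by
        intro y
        have hq : ∀ q < j', padSeq y q = padSeq (Fin.init y : Fin j' → ℝ) q :=
          fun q hq => (padSeq_init y hq).symm
        simp only [f]
        rw [pathWeight_succ K a _ s hc', norm_mul, pathWeight_congr hc' hq, scaled_congr hq,
          Finset.prod_range_succ, padSeq_last,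
          Finset.prod_congr rfl fun q h => hq q (Finset.mem_range.1 h), mul_assoc]
        congr 3
        ring
      have hfm : Measurable (Function.uncurry f) := by
        have msnd : Measurable (Prod.snd : ℝ × (Fin j' → ℝ) → Fin j' → ℝ) := measurable_snd
        have m1 := (measurable_pathWeight hK (j := j') a s
          (Fin.init c : Fin (n + 1) → ℕ × ℕ)).comp msnd
        have m2 := (hK.comp (measurable_scaled_padSeq (j := j') a i j' s)).comp msnd
        have m3 := (measurable_monomial_padSeq (j := j') a i j').comp msnd
        exact m1.norm.mul (m2.norm.mul (((m3.const_mul β).mul measurable_fst).exp))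
      have hint := integrable_norm_pathWeight_mul_exp hμ ha hK hb hβ i (j' + 1) (j' + 1) c
      simp only [hfe] at hint ⊢
      rw [integral_prodLaw_succ hfm.stronglyMeasurable hint, ← integral_const_mul]
      refine integral_mono_of_nonneg (Filter.Eventually.of_forall fun y =>
        integral_nonneg fun v => by positivity)
        ((integrable_norm_pathWeight_mul_exp hμ ha hK hb hβ _ _ _ _).const_mul _) ?_
      filter_upwards [ae_padSeq_mem hμ j'] with y hy
      have h := h₂ _ (monomial_mem_Icc ha hy i j')
      rw [← scaled_eq] at h
      simp only [f]
      rw [integral_const_mul, integral_const_mul, mul_left_comm ρ]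
      exact mul_le_mul_of_nonneg_left h (norm_nonneg _)

/-- Existence of a geometric bound for the mean path weights. -/
theorem exists_integral_norm_pathWeight_le (hμ : ∀ᵐ v ∂μ, v ∈ Set.Ico (0 : ℝ) 1)
    (ha : a ∈ Set.Ico (0 : ℝ) 1) (hK : Measurable K)
    (hKc : ContinuousOn (fun x : ℝ => K (x * s)) (Set.Icc 0 1)) (hK0 : ‖K 0‖ < 1) :
    ∃ b ρ : ℝ, 0 ≤ b ∧ 0 ≤ ρ ∧ ρ < 1 ∧ ∀ {n i j : ℕ} {c : Fin (n + 1) → ℕ × ℕ},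
      IsLatticePath n i j c →
        ∫ y, ‖pathWeight K a (padSeq y) s c‖ ∂(prodLaw μ j) ≤ ρ ^ n * b := by
  obtain ⟨ρ, hρ0, hρ1⟩ := exists_between hK0
  have hρ : 0 ≤ ρ := (norm_nonneg _).trans hρ0.le
  have haI : a ∈ Set.Icc (0 : ℝ) 1 := Set.Ico_subset_Icc_self ha
  obtain ⟨b, hb⟩ := isCompact_Icc.exists_bound_of_continuousOn hKc
  have hκ0 : (fun x : ℝ => ‖K (x * s)‖) 0 < ρ := by simpa using hρ0
  -- A horizontal step is a vertical step whose multiplier has law δ_a, so the same estimate covers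
  -- both and one β serves for both kinds of step.
  have ha' : ∀ᵐ v ∂(Measure.dirac a), v ∈ Set.Ico (0 : ℝ) 1 := by
    exact (ae_dirac_iff measurableSet_Ico).2 ha
  obtain ⟨β, hβ1, hβ2⟩ := ((eventually_mul_integral_exp_le ha' hKc.norm
    (fun _ => norm_nonneg _) hκ0).and (eventually_mul_integral_exp_le hμ hKc.norm
    (fun _ => norm_nonneg _) hκ0)).exists
  simp only [integral_dirac] at hβ1
  have hβ : (0 : ℝ) ≤ β := Nat.cast_nonneg _
  refine ⟨Real.exp β, ρ, (Real.exp_pos _).le, hρ, hρ1, fun {n i j c} hc => ?_⟩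
  refine le_trans ?_ (integral_norm_pathWeight_mul_exp_le hμ haI hK hb hβ hρ hβ1 hβ2 n hc)
  refine integral_mono_ae (integrable_pathWeight hμ haI hK hb c).norm
    (integrable_norm_pathWeight_mul_exp hμ haI hK hb hβ _ _ _ _) ?_
  filter_upwards [ae_padSeq_mem hμ j] with y hy
  exact le_mul_of_one_le_right (norm_nonneg _)
    (Real.one_le_exp (mul_nonneg hβ (monomial_mem_Icc haI hy _ _).1))

end PathBounds

/-! ### The lattice-path series -/

section WeightG

variable {μ : Measure ℝ} [IsProbabilityMeasure μ] {a : ℝ} {K : ℂ → ℂ} {s : ℂ} {b : ℝ}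

theorem measurable_weightG (hK : Measurable K) {l : ℕ} (a : ℝ) (s : ℂ) (i j : ℕ) :
    Measurable fun y : Fin l → ℝ => weightG K a (padSeq y) s i j := by
  simp only [weightG_eq_sum]
  exact Finset.measurable_sum _ fun c _ => measurable_pathWeight hK a s c

theorem integrable_weightG_mul (hμ : ∀ᵐ v ∂μ, v ∈ Set.Ico (0 : ℝ) 1)
    (ha : a ∈ Set.Icc (0 : ℝ) 1) (hK : Measurable K)
    (hb : ∀ x ∈ Set.Icc (0 : ℝ) 1, ‖K (x * s)‖ ≤ b) {l : ℕ} (i j : ℕ)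
    {h : (Fin l → ℝ) → ℂ} (hm : Measurable h) {B : ℝ} (hB : ∀ᵐ y ∂(prodLaw μ l), ‖h y‖ ≤ B) :
    Integrable (fun y => weightG K a (padSeq y) s i j * h y) (prodLaw μ l) := by
  simp only [weightG_eq_sum, Finset.sum_mul]
  exact integrable_finsetSum _ fun c _ => integrable_pathWeight_mul hμ ha hK hb c hm hB

/-- Triangle inequality over the paths, whose number is the binomial coefficient. -/
theorem norm_integral_weightG_mul_le (hμ : ∀ᵐ v ∂μ, v ∈ Set.Ico (0 : ℝ) 1)
    (ha : a ∈ Set.Icc (0 : ℝ) 1) (hK : Measurable K)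
    (hb : ∀ x ∈ Set.Icc (0 : ℝ) 1, ‖K (x * s)‖ ≤ b) {β : ℝ} {i j : ℕ}
    (hβ : ∀ {c : Fin (i + j + 1) → ℕ × ℕ}, IsLatticePath (i + j) i j c →
        ∫ y, ‖pathWeight K a (padSeq y) s c‖ ∂(prodLaw μ j) ≤ β)
    {h : (Fin j → ℝ) → ℂ} (hm : Measurable h) {B : ℝ} (hB0 : 0 ≤ B)
    (hB : ∀ᵐ y ∂(prodLaw μ j), ‖h y‖ ≤ B) :
    ‖∫ y, weightG K a (padSeq y) s i j * h y ∂(prodLaw μ j)‖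
      ≤ (i + j).choose i * (β * B) := by
  simp only [weightG_eq_sum, Finset.sum_mul]
  rw [integral_finsetSum _ fun c _ => integrable_pathWeight_mul hμ ha hK hb c hm hB,
    ← card_latticePaths, ← nsmul_eq_mul]
  refine (norm_sum_le _ _).trans (Finset.sum_le_card_nsmul _ _ _ fun c hc => ?_)
  refine (norm_integral_le_integral_norm _).trans ?_
  refine le_trans ?_ (mul_le_mul_of_nonneg_right (hβ (mem_latticePaths.1 hc)) hB0)
  rw [← integral_mul_const]
  refine integral_mono_ae (integrable_pathWeight_mul hμ ha hK hb c hm hB).norm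
    ((integrable_pathWeight hμ ha hK hb c).norm.mul_const _) ?_
  filter_upwards [hB] with y hy
  rw [norm_mul]
  exact mul_le_mul_of_nonneg_left hy (norm_nonneg _)

/-- `∫⋯∫ G_{i,j}(s) H(f_{i,j}(s)) μ(dy_1) ⋯ μ(dy_j)`. -/
noncomputable def pathTerm (μ : Measure ℝ) (K : ℂ → ℂ) (a : ℝ) (s : ℂ) (H : ℂ → ℂ) (i j : ℕ) : ℂ :=
  ∫ y, weightG K a (padSeq y) s i j * H (scaled a (padSeq y) i j s) ∂(prodLaw μ j)

theorem ae_norm_comp_scaled_le (hμ : ∀ᵐ v ∂μ, v ∈ Set.Ico (0 : ℝ) 1)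
    (ha : a ∈ Set.Icc (0 : ℝ) 1) {H : ℂ → ℂ} {B : ℝ}
    (hB : ∀ x ∈ Set.Icc (0 : ℝ) 1, ‖H (x * s)‖ ≤ B) (l i j : ℕ) :
    ∀ᵐ y ∂(prodLaw μ l), ‖H (scaled a (padSeq y) i j s)‖ ≤ B := by
  filter_upwards [ae_padSeq_mem hμ l] with y hy
  rw [scaled_eq]
  exact hB _ (monomial_mem_Icc ha hy i j)

theorem integrable_pathTerm (hμ : ∀ᵐ v ∂μ, v ∈ Set.Ico (0 : ℝ) 1)
    (ha : a ∈ Set.Icc (0 : ℝ) 1) (hK : Measurable K)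
    (hb : ∀ x ∈ Set.Icc (0 : ℝ) 1, ‖K (x * s)‖ ≤ b) {H : ℂ → ℂ} (hH : Measurable H) {B : ℝ}
    (hB : ∀ x ∈ Set.Icc (0 : ℝ) 1, ‖H (x * s)‖ ≤ B) (i j : ℕ) :
    Integrable (fun y => weightG K a (padSeq y) s i j * H (scaled a (padSeq y) i j s))
      (prodLaw μ j) :=
  integrable_weightG_mul hμ ha hK hb i j (hH.comp (measurable_scaled_padSeq a i j s))
    (ae_norm_comp_scaled_le hμ ha hB j i j)

/-- The weight up to (i,j) and the factor K do not involve the last variable, so integrating that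
variable acts on H alone and leaves a term with one variable fewer. -/
theorem integral_weightG_vertical (hμ : ∀ᵐ v ∂μ, v ∈ Set.Ico (0 : ℝ) 1)
    (ha : a ∈ Set.Icc (0 : ℝ) 1) (hK : Measurable K)
    (hb : ∀ x ∈ Set.Icc (0 : ℝ) 1, ‖K (x * s)‖ ≤ b) {H : ℂ → ℂ} (hH : Measurable H) {B : ℝ}
    (hB : ∀ x ∈ Set.Icc (0 : ℝ) 1, ‖H (x * s)‖ ≤ B) (i j : ℕ) :
    Integrable (fun y => weightG K a (padSeq y) s i j * (K (scaled a (padSeq y) i j s)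
        * H (scaled a (padSeq y) i (j + 1) s))) (prodLaw μ (j + 1)) ∧
    ∫ y, weightG K a (padSeq y) s i j * (K (scaled a (padSeq y) i j s)
        * H (scaled a (padSeq y) i (j + 1) s)) ∂(prodLaw μ (j + 1))
      = pathTerm μ K a s (fun z => K z * ∫ v, H (z * (v : ℂ)) ∂μ) i j := by
  have hint : Integrable (fun y => weightG K a (padSeq y) s i j * (K (scaled a (padSeq y) i j s)
        * H (scaled a (padSeq y) i (j + 1) s))) (prodLaw μ (j + 1)) := by
    refine integrable_weightG_mul hμ ha hK hb (B := b * B) i j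
      ((hK.comp (measurable_scaled_padSeq a i j s)).mul
        (hH.comp (measurable_scaled_padSeq a i (j + 1) s))) ?_
    filter_upwards [ae_norm_comp_scaled_le hμ ha hb (j + 1) i j,
      ae_norm_comp_scaled_le hμ ha hB (j + 1) i (j + 1)] with y h1 h2
    rw [norm_mul]
    exact mul_le_mul h1 h2 (norm_nonneg _) ((norm_nonneg _).trans h1)
  refine ⟨hint, ?_⟩
  let f : ℝ → (Fin j → ℝ) → ℂ := fun v y => weightG K a (padSeq y) s i j *
    (K (scaled a (padSeq y) i j s) * H (scaled a (padSeq y) i j s * (v : ℂ)))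
  have hfe : ∀ y : Fin (j + 1) → ℝ, weightG K a (padSeq y) s i j *
      (K (scaled a (padSeq y) i j s) * H (scaled a (padSeq y) i (j + 1) s))
      = f (y (Fin.last j)) (Fin.init y) := by
    intro y
    have hq : ∀ q < j, padSeq y q = padSeq (Fin.init y : Fin j → ℝ) q :=
      fun q hq => (padSeq_init y hq).symm
    simp only [f]
    rw [scaled_succ_right, weightG_congr hq, scaled_congr hq, padSeq_last]
  have hfm : Measurable (Function.uncurry f) := by
    have msnd : Measurable (Prod.snd : ℝ × (Fin j → ℝ) → Fin j → ℝ) := measurable_snd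
    have m1 := (measurable_weightG hK (l := j) a s i j).comp msnd
    have m2 := (measurable_scaled_padSeq (j := j) a i j s).comp msnd
    exact m1.mul ((hK.comp m2).mul (hH.comp (m2.mul
      (Complex.measurable_ofReal.comp measurable_fst))))
  simp only [hfe] at hint ⊢
  rw [integral_prodLaw_succ hfm.stronglyMeasurable hint, pathTerm]
  refine integral_congr_ae (Filter.Eventually.of_forall fun y => ?_)
  simp only [f]
  rw [integral_const_mul, integral_const_mul]

theorem bound_mul_comp (ha : a ∈ Set.Icc (0 : ℝ) 1)
    (hb : ∀ x ∈ Set.Icc (0 : ℝ) 1, ‖K (x * s)‖ ≤ b) {H : ℂ → ℂ} {B : ℝ}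
    (hB : ∀ x ∈ Set.Icc (0 : ℝ) 1, ‖H (x * s)‖ ≤ B) :
    ∀ x ∈ Set.Icc (0 : ℝ) 1, ‖(fun z => K z * H (a * z)) (x * s)‖ ≤ b * B := by
  intro x hx
  have h := hB (a * x) ⟨mul_nonneg ha.1 hx.1, mul_le_one₀ ha.2 hx.1 hx.2⟩
  rw [Complex.ofReal_mul, mul_assoc] at h
  simp only [norm_mul]
  exact mul_le_mul (hb x hx) h (norm_nonneg _) ((norm_nonneg _).trans (hb x hx))

theorem bound_mul_integral (hμ : ∀ᵐ v ∂μ, v ∈ Set.Ico (0 : ℝ) 1)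
    (hb : ∀ x ∈ Set.Icc (0 : ℝ) 1, ‖K (x * s)‖ ≤ b) {H : ℂ → ℂ} {B : ℝ}
    (hB : ∀ x ∈ Set.Icc (0 : ℝ) 1, ‖H (x * s)‖ ≤ B) :
    ∀ x ∈ Set.Icc (0 : ℝ) 1,
      ‖(fun z => K z * ∫ v, H (z * (v : ℂ)) ∂μ) (x * s)‖ ≤ b * B := by
  intro x hx
  have h : ‖∫ v : ℝ, H (x * s * (v : ℂ)) ∂μ‖ ≤ B := by
    have := norm_integral_le_of_norm_le_const (μ := μ) (f := fun v : ℝ => H (x * s * (v : ℂ)))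
      (C := B) (by
        filter_upwards [hμ] with v hv
        have h := hB (x * v) ⟨mul_nonneg hx.1 hv.1, mul_le_one₀ hx.2 hv.1 hv.2.le⟩
        rwa [Complex.ofReal_mul, mul_right_comm] at h)
    simpa using this
  simp only [norm_mul]
  exact mul_le_mul (hb x hx) h (norm_nonneg _) ((norm_nonneg _).trans (hb x hx))

theorem measurable_mul_integral (hK : Measurable K) {H : ℂ → ℂ} (hH : Measurable H) :
    Measurable fun z => K z * ∫ v, H (z * (v : ℂ)) ∂μ := by
  have : StronglyMeasurable (Function.uncurry fun (z : ℂ) (v : ℝ) => H (z * (v : ℂ))) :=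
    (hH.comp (measurable_fst.mul (Complex.measurable_ofReal.comp
      measurable_snd))).stronglyMeasurable
  exact hK.mul (this.integral_prod_right).measurable

/-- Solution of a linear two-branch functional equation by its lattice-path series. -/
theorem hasSum_pathTerm (hμ : ∀ᵐ v ∂μ, v ∈ Set.Ico (0 : ℝ) 1)
    (ha : a ∈ Set.Ico (0 : ℝ) 1) (hK : Measurable K)
    (hKc : ContinuousOn (fun x : ℝ => K (x * s)) (Set.Icc 0 1)) (hK0 : ‖K 0‖ < 1)
    {p₁ p₂ : ℝ} (hp₁ : 0 ≤ p₁) (hp₂ : 0 ≤ p₂) (hp : p₁ + p₂ ≤ 1)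
    {H F : ℂ → ℂ} (hH : Measurable H) (hF : Measurable F) {B : ℝ}
    (hB : ∀ x ∈ Set.Icc (0 : ℝ) 1, ‖H (x * s)‖ ≤ B)
    (hBF : ∀ x ∈ Set.Icc (0 : ℝ) 1, ‖F (x * s)‖ ≤ B)
    (heq : ∀ x ∈ Set.Icc (0 : ℝ) 1, H (x * s) = p₁ * (K (x * s) * H (a * (x * s)))
      + p₂ * (K (x * s) * ∫ v, H (x * s * (v : ℂ)) ∂μ) + F (x * s)) :
    HasSum (fun k : ℕ => ∑ x ∈ Finset.HasAntidiagonal.antidiagonal k,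
      (p₁ : ℂ) ^ x.1 * (p₂ : ℂ) ^ x.2 * pathTerm μ K a s F x.1 x.2) (H s) := by
  obtain ⟨c, ρ, hc, hρ0, hρ1, hpath⟩ := exists_integral_norm_pathWeight_le hμ ha hK hKc hK0
  obtain ⟨b, hb⟩ := isCompact_Icc.exists_bound_of_continuousOn hKc
  have haI : a ∈ Set.Icc (0 : ℝ) 1 := Set.Ico_subset_Icc_self ha
  have hB0 : 0 ≤ B := (norm_nonneg _).trans (hB 0 (by simp))
  -- The level-k sum with an arbitrary terminal function. With H as terminal function it is the
  -- remainder after k iterations of the functional equation.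
  set S : (ℂ → ℂ) → ℕ → ℂ := fun H k => ∑ x ∈ Finset.HasAntidiagonal.antidiagonal k,
      (p₁ : ℂ) ^ x.1 * (p₂ : ℂ) ^ x.2 * pathTerm μ K a s H x.1 x.2 with hS
  -- The path counts combine with the powers of p₁ and p₂ into (p₁ + p₂)^k ≤ 1, so the decay ρ^k of
  -- a single path survives.
  have hbound : ∀ G : ℂ → ℂ, Measurable G → (∀ x ∈ Set.Icc (0 : ℝ) 1, ‖G (x * s)‖ ≤ B) →
      ∀ k, ‖S G k‖ ≤ ρ ^ k * (c * B) := by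
    intro G hG hBG k
    refine (norm_sum_le _ _).trans ?_
    calc _ ≤ ∑ x ∈ Finset.HasAntidiagonal.antidiagonal k,
          (p₁ ^ x.1 * p₂ ^ x.2 * k.choose x.1) * (ρ ^ k * c * B) := by
          refine Finset.sum_le_sum fun x hx => ?_
          rw [Finset.HasAntidiagonal.mem_antidiagonal] at hx
          subst hx
          have := norm_integral_weightG_mul_le hμ haI hK hb (i := x.1) (j := x.2)
            (fun h => hpath h)
            (hG.comp (measurable_scaled_padSeq a x.1 x.2 s)) hB0
            (ae_norm_comp_scaled_le hμ haI hBG x.2 x.1 x.2)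
          rw [norm_mul, norm_mul, norm_pow, norm_pow, Complex.norm_real, Complex.norm_real,
            Real.norm_of_nonneg hp₁, Real.norm_of_nonneg hp₂, mul_assoc (p₁ ^ x.1 * p₂ ^ x.2)]
          exact mul_le_mul_of_nonneg_left this (by positivity)
      _ = (p₁ + p₂) ^ k * (ρ ^ k * c * B) := by
          rw [← Finset.sum_mul, Finset.Nat.sum_antidiagonal_eq_sum_range_succ_mk, add_pow]
      _ ≤ 1 * (ρ ^ k * c * B) := by
          refine mul_le_mul_of_nonneg_right (pow_le_one₀ (by positivity) hp) (by positivity)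
      _ = _ := by ring
  set H₁ : ℂ → ℂ := fun z => K z * H (a * z) with hH₁
  set H₂ : ℂ → ℂ := fun z => K z * ∫ v, H (z * (v : ℂ)) ∂μ with hH₂
  have hH₁m : Measurable H₁ := hK.mul (hH.comp (measurable_const_mul _))
  have hH₂m : Measurable H₂ := measurable_mul_integral hK hH
  have hH₁b := bound_mul_comp haI hb hB
  have hH₂b := bound_mul_integral hμ hb hB
  have hstep : ∀ k, S H (k + 1) = p₁ * S H₁ k + p₂ * S H₂ k := by
    refine sum_antidiagonal_step _ _ (fun i => ?_) (fun j => ?_) fun i j => ?_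
    · simp only [pathTerm, hH₁]
      refine integral_congr_ae (Filter.Eventually.of_forall fun y => ?_)
      simp only [weightG, scaled_succ_left, mul_assoc]
    · rw [hH₂, ← (integral_weightG_vertical hμ haI hK hb hH hB 0 j).2, pathTerm]
      refine integral_congr_ae (Filter.Eventually.of_forall fun y => ?_)
      simp only [weightG, mul_assoc]
    · have hv := integral_weightG_vertical hμ haI hK hb hH hB (i + 1) j
      rw [hH₂, ← hv.2, pathTerm, pathTerm, ← integral_add
        (integrable_pathTerm hμ haI hK hb hH₁m hH₁b i (j + 1)) hv.1]
      refine integral_congr_ae (Filter.Eventually.of_forall fun y => ?_)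
      simp only [weightG, hH₁, scaled_succ_left, add_mul, mul_assoc]
  have hterm : ∀ i j, pathTerm μ K a s H i j = p₁ * pathTerm μ K a s H₁ i j
      + p₂ * pathTerm μ K a s H₂ i j + pathTerm μ K a s F i j := by
    intro i j
    have i1 := (integrable_pathTerm hμ haI hK hb hH₁m hH₁b i j).const_mul (p₁ : ℂ)
    have i2 := (integrable_pathTerm hμ haI hK hb hH₂m hH₂b i j).const_mul (p₂ : ℂ)
    have i3 := integrable_pathTerm hμ haI hK hb hF hBF i j
    simp only [pathTerm]
    rw [← integral_const_mul, ← integral_const_mul, ← integral_add i1 i2, ← integral_add]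
    · refine integral_congr_ae ?_
      filter_upwards [ae_padSeq_mem hμ j] with y hy
      have h := heq _ (monomial_mem_Icc haI hy i j)
      rw [← scaled_eq] at h
      rw [h]
      simp only [hH₁, hH₂]
      ring
    · exact i1.add i2
    · exact i3
  -- One more use of the functional equation at every level-k end point: the two branches form level
  -- k + 1 and the free term is emitted. The sum over k then telescopes.
  have hsplit : ∀ k, S H k = S H (k + 1) + S F k := by
    intro k
    rw [hstep]
    simp only [hS, Finset.mul_sum, ← Finset.sum_add_distrib]
    refine Finset.sum_congr rfl fun x _ => ?_
    rw [hterm]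
    ring
  have h0 : S H 0 = H s := by
    simp [hS, pathTerm, weightG, scaled]
  have hpartial : ∀ n, ∑ k ∈ Finset.range n, S F k = H s - S H n := by
    intro n
    induction n with
    | zero => simp [h0]
    | succ n ih => rw [Finset.sum_range_succ, ih, hsplit n]; ring
  have hgeo : Summable fun k : ℕ => ρ ^ k * (c * B) :=
    (summable_geometric_of_lt_one hρ0 hρ1).mul_right _
  have hsum : Summable (S F) := Summable.of_norm_bounded hgeo (hbound F hF hBF)
  have hlim : Filter.Tendsto (fun n => ∑ k ∈ Finset.range n, S F k) Filter.atTop (nhds (H s)) := by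
    simp only [hpartial]
    have := squeeze_zero_norm (hbound H hH hB) hgeo.tendsto_atTop_zero
    simpa using tendsto_const_nhds.sub this
  rw [← tendsto_nhds_unique hsum.hasSum.tendsto_sum_nat hlim]
  exact hsum.hasSum

end WeightG

/-! ### Specialisation to the kernel K and the free term, and assembly -/

theorem continuous_polyC {d : ℕ} (C : Fin (d + 1) → ℂ) : Continuous (polyC C) := by
  unfold polyC
  fun_prop

theorem measurable_kernK {L M : ℕ} (N : Polynomial ℂ) (t : Fin L → ℂ) (u : Fin M → ℂ) (r : ℝ) :
    Measurable (kernK N t u r) :=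
  (N.continuous.measurable.div (differentiable_denomY t u).continuous.measurable).const_mul _

theorem measurable_freeL {L M : ℕ} (t : Fin L → ℂ) (u : Fin M → ℂ) (w : ℝ)
    (C : Fin (M + L + 1) → ℂ) : Measurable (freeL t u w C) :=
  (by fun_prop : Measurable fun s : ℂ => Complex.exp (-s * (w : ℂ))).add
    ((continuous_polyC C).measurable.div (differentiable_denomY t u).continuous.measurable)

section Segment

variable {L M : ℕ} {t : Fin L → ℂ} {u : Fin M → ℂ} {s : ℂ}
  (hD : ∀ x ∈ Set.Icc (0 : ℝ) 1, denomY t u (x * s) ≠ 0)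
include hD

theorem continuousOn_kernK_segment (N : Polynomial ℂ) (r : ℝ) :
    ContinuousOn (fun x : ℝ => kernK N t u r (x * s)) (Set.Icc 0 1) := by
  have h1 : Continuous fun x : ℝ => (x : ℂ) * s := by fun_prop
  exact continuousOn_const.mul ((N.continuous.comp h1).continuousOn.div
    ((differentiable_denomY t u).continuous.comp h1).continuousOn hD)

theorem continuousOn_freeL_segment (w : ℝ) (C : Fin (M + L + 1) → ℂ) :
    ContinuousOn (fun x : ℝ => freeL t u w C (x * s)) (Set.Icc 0 1) := by
  have h1 : Continuous fun x : ℝ => (x : ℂ) * s := by fun_prop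
  exact (by fun_prop : Continuous fun x : ℝ => Complex.exp (-(x * s) * (w : ℂ))).continuousOn.add
    (((continuous_polyC C).comp h1).continuousOn.div
      ((differentiable_denomY t u).continuous.comp h1).continuousOn hD)

end Segment

theorem functional_equation_of_half_plane {L M : ℕ} {t : Fin L → ℂ} {u : Fin M → ℂ}
    {N : Polynomial ℂ} {r w p₁ p₂ : ℝ} {C : Fin (M + L + 1) → ℂ} {s z z₁ z₂ : ℂ}
    (h : denomY t u s * (z - Complex.exp (-s * (w : ℂ))) - (r : ℂ) * p₁ * N.eval s * z₁
      - (r : ℂ) * p₂ * N.eval s * z₂ = polyC C s) (hD : denomY t u s ≠ 0) :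
    z = p₁ * kernK N t u r s * z₁ + p₂ * kernK N t u r s * z₂ + freeL t u w C s := by
  rw [freeL, kernK, ← h]
  field_simp
  ring

/-- The geometric factor is at most 1, which leaves a constant independent of the path, of k and of
m. -/
theorem bounded_path_weights {μ : Measure ℝ} [IsProbabilityMeasure μ] {a : ℝ} {K : ℂ → ℂ} {s : ℂ}
    (hμ : ∀ᵐ v ∂μ, v ∈ Set.Ico (0 : ℝ) 1)
    (ha : a ∈ Set.Ico (0 : ℝ) 1) (hK : Measurable K)
    (hKc : ContinuousOn (fun x : ℝ => K (x * s)) (Set.Icc 0 1)) (hK0 : ‖K 0‖ < 1) :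
    ∃ b : ℝ, ∀ k m : ℕ, m ≤ k →
      (∀ c ∈ latticePaths k m (k - m),
        Integrable (fun y => pathWeight K a (padSeq y) s c) (prodLaw μ (k - m)) ∧
        ∫ y, ‖pathWeight K a (padSeq y) s c‖ ∂(prodLaw μ (k - m)) ≤ b) ∧
      ‖∫ y, weightG K a (padSeq y) s m (k - m) ∂(prodLaw μ (k - m))‖ ≤ k.choose m * b := by
  obtain ⟨c, ρ, hc, hρ0, hρ1, hpath⟩ := exists_integral_norm_pathWeight_le hμ ha hK hKc hK0
  obtain ⟨b, hb⟩ := isCompact_Icc.exists_bound_of_continuousOn hKc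
  have haI : a ∈ Set.Icc (0 : ℝ) 1 := Set.Ico_subset_Icc_self ha
  have hle : ∀ {n i j : ℕ} {p : Fin (n + 1) → ℕ × ℕ}, IsLatticePath n i j p →
      ∫ y, ‖pathWeight K a (padSeq y) s p‖ ∂(prodLaw μ j) ≤ c := fun h =>
    (hpath h).trans (mul_le_of_le_one_left hc (pow_le_one₀ hρ0 hρ1.le))
  refine ⟨c, fun k m hm => ?_⟩
  generalize hl : k - m = l
  obtain rfl : k = m + l := by omega
  refine ⟨fun p hp => ⟨integrable_pathWeight hμ haI hK hb p, hle (mem_latticePaths.1 hp)⟩, ?_⟩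
  simpa using norm_integral_weightG_mul_le hμ haI hK hb (i := m) (j := l) (fun h => hle h)
    (h := fun _ => 1) measurable_const (B := 1) zero_le_one (by simp)

theorem mainTheorem7 {Ω : Type*} [MeasurableSpace Ω] (P : Measure Ω) [IsProbabilityMeasure P]
    (V B A : ℕ → Ω → ℝ)
    (hVm : ∀ n, Measurable (V n)) (hBm : ∀ n, Measurable (B n)) (hAm : ∀ n, Measurable (A n))
    -- the `V_n` and the `Y_n = B_n - A_n` are mutually independent
    (hind : iIndepFun (Sum.elim V fun n ω => B n ω - A n ω) P)
    -- law of `V_n`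
    (a p₁ p₂ : ℝ) (ha : a ∈ Set.Ioo (0 : ℝ) 1) (hp₁ : 0 ≤ p₁) (hp₂ : 0 ≤ p₂) (hp : p₁ + p₂ ≤ 1)
    (μ ν : Measure ℝ) [IsProbabilityMeasure μ] [IsProbabilityMeasure ν]
    (hμ : μ (Set.Ico 0 1) = 1) (hν : ν (Set.Iio 0) = 1)
    (hV : ∀ n, P.map (V n) =
      ENNReal.ofReal p₁ • Measure.dirac a + ENNReal.ofReal p₂ • μ
        + ENNReal.ofReal (1 - p₁ - p₂) • ν)
    -- common law of the `Y_n`, with a rational transform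
    (η : Measure ℝ) (hY : ∀ n, P.map (fun ω => B n ω - A n ω) = η)
    {L M : ℕ} (N : Polynomial ℂ) (t : Fin L → ℂ) (u : Fin M → ℂ)
    (ht : ∀ j, 0 < (t j).re) (hu : ∀ j, (u j).re < 0)
    (hφ : ∀ s : ℂ, s.re = 0 →
      ∫ y, Complex.exp (-s * (y : ℂ)) ∂η = N.eval s / denomY t u s)
    -- initial state and discount factor
    (w : ℝ) (hw : 0 ≤ w) (r : ℝ) (hr₀ : 0 ≤ r) (hr₁ : r < 1) :
    let Z : ℂ → ℂ := transZ P w V B A r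
    let D : ℂ → ℂ := denomY t u
    let K : ℂ → ℂ := kernK N t u r
    ContinuousOn Z {s | 0 ≤ s.re} ∧ DifferentiableOn ℂ Z {s | 0 < s.re} ∧
    ∃ C : Fin (M + L + 1) → ℂ,
      -- the two half-plane identities that define the coefficients
      (∀ s : ℂ, 0 ≤ s.re →
        D s * (Z s - Complex.exp (-s * (w : ℂ)))
          - (r : ℂ) * p₁ * N.eval s * Z (a * s)
          - (r : ℂ) * p₂ * N.eval s * ∫ y, Z (s * (y : ℂ)) ∂μ = polyC C s) ∧
      (∀ s : ℂ, s.re ≤ 0 →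
        (r : ℂ) * (1 - p₁ - p₂) * N.eval s * (∫ y, Z (s * (y : ℂ)) ∂ν)
          + (r : ℂ) * D s * (1 / (1 - (r : ℂ)) - transJ P w V B A r s) = polyC C s) ∧
      -- the functional equation
      (∀ s : ℂ, 0 ≤ s.re → D s ≠ 0 →
        Z s = p₁ * K s * Z (a * s) + p₂ * K s * (∫ y, Z (s * (y : ℂ)) ∂μ) + freeL t u w C s) ∧
      -- `G` is the total weight of all lattice paths
      (∀ (y : ℕ → ℝ) (s : ℂ) (i j : ℕ),
        weightG K a y s i j = ∑ c ∈ latticePaths (i + j) i j, pathWeight K a y s c) ∧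
      (∀ i j : ℕ, (latticePaths (i + j) i j).card = (i + j).choose i) ∧
      -- bounded path weights and the lattice-path series
      (∀ s : ℂ, 0 ≤ s.re → (∀ x ∈ Set.Icc (0 : ℝ) 1, D (x * s) ≠ 0) →
        (∃ b : ℝ, ∀ k m : ℕ, m ≤ k →
          (∀ c ∈ latticePaths k m (k - m),
            Integrable (fun y => pathWeight K a (padSeq y) s c) (prodLaw μ (k - m)) ∧
            ∫ y, ‖pathWeight K a (padSeq y) s c‖ ∂(prodLaw μ (k - m)) ≤ b) ∧
          ‖∫ y, weightG K a (padSeq y) s m (k - m) ∂(prodLaw μ (k - m))‖ ≤ k.choose m * b) ∧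
        (∀ i j : ℕ, Integrable
          (fun y => weightG K a (padSeq y) s i j * freeL t u w C (scaled a (padSeq y) i j s))
          (prodLaw μ j)) ∧
        HasSum (fun k : ℕ => ∑ m ∈ Finset.range (k + 1),
          (p₁ : ℂ) ^ m * (p₂ : ℂ) ^ (k - m) *
            ∫ y, weightG K a (padSeq y) s m (k - m) *
              freeL t u w C (scaled a (padSeq y) m (k - m) s) ∂(prodLaw μ (k - m)))
          (Z s)) ∧
      -- the linear system for the coefficients
      C 0 = (r : ℂ) * (1 - p₁ - p₂) / (1 - r) * ((∏ j, -t j) * ∏ j, -u j) ∧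
      SystemT N t Z μ a p₁ p₂ r C ∧
      SystemS N u Z ν p₁ p₂ r C ∧
      (Function.Injective t → Function.Injective u →
        ∀ C' : Fin (M + L + 1) → ℂ, C' 0 = C 0 → SystemT N t Z μ a p₁ p₂ r C' →
          SystemS N u Z ν p₁ p₂ r C' → C' = C) := by
  intro Z D K
  have hμ' : ∀ᵐ v ∂μ, v ∈ Set.Ico (0 : ℝ) 1 := ae_mem_of_measure_eq_one measurableSet_Ico hμ
  have hμ0 : ∀ᵐ v ∂μ, (0 : ℝ) ≤ v := hμ'.mono fun v hv => hv.1
  have hν0 : ∀ᵐ v ∂ν, v ≤ (0 : ℝ) :=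
    (ae_mem_of_measure_eq_one measurableSet_Iio hν).mono fun v hv => le_of_lt hv
  have haI : a ∈ Set.Ico (0 : ℝ) 1 := ⟨ha.1.le, ha.2⟩
  have hη : IsProbabilityMeasure η := by
    rw [← hY 0]
    exact Measure.isProbabilityMeasure_map ((hBm 0).sub (hAm 0)).aemeasurable
  have hZc : ContinuousOn Z {s | 0 ≤ s.re} := continuousOn_transZ hVm hBm hAm hr₀ hr₁ hw
  have hD0 : D 0 ≠ 0 := denomY_ne_zero ht hu (by simp)
  -- The law of Y has total mass 1. Hence K(0) = r < 1, the input for the decay of path weights.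
  have hN0 : N.eval 0 = D 0 := by
    have := hφ 0 (by simp)
    simp only [neg_zero, zero_mul, Complex.exp_zero, integral_const, probReal_univ, one_smul] at this
    exact ((div_eq_one_iff_eq hD0).1 this.symm)
  have hK0 : ‖K 0‖ < 1 := by
    have : K 0 = r := by
      simp only [K, kernK]
      rw [hN0, div_self hD0, mul_one]
    rw [this, Complex.norm_real, Real.norm_of_nonneg hr₀]
    exact hr₁
  have hZ0 : Z 0 = 1 / (1 - (r : ℂ)) := transZ_zero hr₀ hr₁
  have hr : (1 : ℂ) - r ≠ 0 := by
    rw [← Complex.ofReal_one, ← Complex.ofReal_sub, Complex.ofReal_ne_zero]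
    exact (sub_pos.2 hr₁).ne'
  obtain ⟨C, hC₁, hC₂⟩ := exists_polyC_half_planes (P := P) hVm hBm hAm hr₀ hr₁ hind haI.1 hp₁ hp₂
    hp hμ0 hν0 hV hY ht hu hφ hw
  have hfe : ∀ s : ℂ, 0 ≤ s.re → D s ≠ 0 →
      Z s = p₁ * K s * Z (a * s) + p₂ * K s * (∫ y, Z (s * (y : ℂ)) ∂μ) + freeL t u w C s :=
    fun s hs hDs => functional_equation_of_half_plane (hC₁ s hs) hDs
  -- At a zero t_j the factor D kills the term Z - exp(-sw); at u_j below it kills the term with J⁻.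
  have hT : SystemT N t Z μ a p₁ p₂ r C := by
    intro j
    rw [← hC₁ (t j) (ht j).le, denomY_left]
    ring
  have hS : SystemS N u Z ν p₁ p₂ r C := by
    intro j
    rw [← hC₂ (u j) (hu j).le, denomY_right]
    ring
  refine ⟨hZc, differentiableOn_transZ hVm hBm hAm hr₀ hr₁ hw, C, hC₁, hC₂, hfe,
    fun y s i j => weightG_eq_sum K a y s i j, card_latticePaths, ?_, ?_, hT, hS, ?_⟩
  · intro s hs hDs
    have hKm : Measurable K := measurable_kernK N t u r
    have hFm := measurable_freeL t u w C
    have hKc := continuousOn_kernK_segment hDs N r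
    obtain ⟨b, hb⟩ := isCompact_Icc.exists_bound_of_continuousOn hKc
    obtain ⟨B, hB⟩ := isCompact_Icc.exists_bound_of_continuousOn (continuousOn_freeL_segment hDs w C)
    refine ⟨bounded_path_weights hμ' haI hKm hKc hK0, fun i j =>
      integrable_pathTerm hμ' (Set.Ico_subset_Icc_self haI) hKm hb hFm hB i j, ?_⟩
    have hcl : MeasurableSet {z : ℂ | 0 ≤ z.re} :=
      (isClosed_le continuous_const Complex.continuous_re).measurableSet
    classical
    -- Z is controlled only on the closed right half plane. Replacing it by 0 elsewhere gives a
    -- globally measurable function with the same values on every point that the iteration reaches.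
    let H : ℂ → ℂ := {z : ℂ | 0 ≤ z.re}.piecewise Z 0
    have hHZ : ∀ z : ℂ, 0 ≤ z.re → H z = Z z := fun z hz => Set.piecewise_eq_of_mem _ _ _ hz
    have hHm : Measurable H := hZc.measurable_piecewise continuousOn_const hcl
    have hre : ∀ x ∈ Set.Icc (0 : ℝ) 1, 0 ≤ ((x : ℂ) * s).re := fun x hx => by
      simpa using mul_nonneg hx.1 hs
    have hHb : ∀ x ∈ Set.Icc (0 : ℝ) 1, ‖H (x * s)‖ ≤ max B (1 - r)⁻¹ := fun x hx => by
      rw [hHZ _ (hre x hx)]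
      exact (norm_transZ_le hw hr₀ hr₁ (hre x hx)).trans (le_max_right _ _)
    have hsum := hasSum_pathTerm hμ' haI hKm hKc hK0 hp₁ hp₂ hp hHm hFm hHb
      (fun x hx => (hB x hx).trans (le_max_left _ _)) (fun x hx => by
        have h1 : H (a * (x * s)) = Z (a * (x * s)) := hHZ _ (by
          rw [Complex.re_ofReal_mul]
          exact mul_nonneg haI.1 (hre x hx))
        have h2 : ∫ v : ℝ, H (x * s * (v : ℂ)) ∂μ = ∫ v : ℝ, Z (x * s * (v : ℂ)) ∂μ := by
          refine integral_congr_ae ?_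
          filter_upwards [hμ0] with v hv
          refine hHZ _ ?_
          rw [Complex.re_mul_ofReal]
          exact mul_nonneg (hre x hx) hv
        rw [h1, h2, hHZ _ (hre x hx), hfe _ (hre x hx) (hDs x hx)]
        ring)
    rw [hHZ s hs] at hsum
    refine hsum.congr_fun fun k => ?_
    exact (Finset.Nat.sum_antidiagonal_eq_sum_range_succ (fun i j =>
      (p₁ : ℂ) ^ i * (p₂ : ℂ) ^ j * pathTerm μ K a s (freeL t u w C) i j) k).symm
  -- At s = 0 all values of Z equal 1/(1-r), so the identity reduces to D(0) times r(1 - p₁ -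
  -- p₂)/(1-r).
  · have h := hC₁ 0 (by simp)
    simp only [neg_zero, zero_mul, mul_zero, Complex.exp_zero, integral_const, probReal_univ,
      one_smul] at h
    rw [polyC_zero_arg, hN0] at h
    change D 0 * (Z 0 - 1) - r * p₁ * D 0 * Z 0 - r * p₂ * D 0 * Z 0 = C 0 at h
    have hD0' : D 0 = (∏ j, -t j) * ∏ j, -u j := by simp [D, denomY]
    rw [← h, ← hD0', hZ0]
    field_simp
    ring
  · intro htinj huinj C' h0 hT' hS'
    exact polyC_injective_of_nodes ht hu htinj huinj h0 (fun j => (hT' j).symm.trans (hT j))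
      fun j => (hS' j).symm.trans (hS j)
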